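/- **Model.** For $T\in\mathbb N$ let $X_t=f_t+\epsilon_t$, $t=1,\dots,T$, with $\epsilon_t$ i.i.d. $N(0,1)$ and a deterministic signal $f=f^{(T)}$ that may depend on $T$. Its change points $\eta_1<\dots<\eta_N$ are the $t\in\{1,\dots,T-1\}$ with $f_{t+1}\ne f_t$; put $\eta_0=0$, $\eta_{N+1}=T$, $\delta_i=|f_{\eta_i+1}-f_{\eta_i}|$, $\delta_*=\min_{1\le i\le N}\delta_i$ and $\lambda=\min_{0\le i\le N}(\eta_{i+1}-\eta_i)$. For $C>0$ let $(\mathrm A_C)$ be the condition $\delta_*^2\lambda\ge C\log T$ (no condition if $N=0$). **Procedure.** For a decay $a\in[1/2,1)$ and $1\le k\le\lceil\log_{1/a}T\rceil$ put $n_k=2\lceil(1/a)^{k-1}\rceil-1$, $l_k=Ta^{k-1}$, $s_k=(T-l_k)/(n_k-1)$ ($s_1:=0$). The seeded intervals are $(\lfloor(i-1)s_k\rfloor,\lceil(i-1)s_k+l_k\rceil]$, $1\le i\le n_k$, over all these $k$; those with fewer than $m$ observations are dropped, where $m\ge2$ is a given minimal segment length. For an interval $(\ell,r]$ and $s\in\{\ell+1,\dots,r-1\}$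 let $$T_{(\ell,r]}(s)=\sqrt{\tfrac{r-s}{(r-\ell)(s-\ell)}}\sum_{t=\ell+1}^sX_t-\sqrt{\tfrac{s-\ell}{(r-\ell)(r-s)}}\sum_{t=s+1}^rX_t ,$$ and let $\hat s_{(\ell,r]}$ be a maximiser of $|T_{(\ell,r]}(\cdot)|$. Narrowest-over-threshold selection with threshold $\kappa$ keeps the intervals with $|T_{(\ell,r]}(\hat s_{(\ell,r]})|>\kappa$, takes a shortest one of them, records its $\hat s_{(\ell,r]}$ as an estimated change point, discards all intervals $(\ell',r']$ with $\ell'<\hat s_{(\ell,r]}\le r'$, and repeats this with the remaining intervals until none is left; ties are broken arbitrarily. Let $\hat\eta_1<\dots<\hat\eta_{\hat N}$ be the estimated change points. **Theorem.** 1. There are absolute constants $C_0,C_1,C_2>0$ (in particular independent of $T$ and $a$) such that the following holds for every $a\in[1/2,1)$, all $m=m_T\ge2$ and all signals $f=f^{(T)}$ such that, for all large $T$, $(\mathrm A_{C_0})$ holds and $m\le a\lambda+1$ (for $m=2$ this says $\lambda\ge2$): with the threshold $\kappa=C_1\log^{1/2}T$, as $T\to\infty$, $$\Pr\Big\{\hat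 N=N,\ \max_{1\le i\le N}\delta_i^2|\hat\eta_i-\eta_i|\le C_2\log T\Big\}\to1,$$ where the event is that these relations hold for every way of breaking ties. 2. The rates are minimax optimal up to constants: (i) there are $c_0>0$ and $p<1$ such that, for all large $T$ and every measurable estimator $\hat N$ of the number of change points based on $X_1,\dots,X_T$, some signal with $\lambda\ge2$ satisfies $(\mathrm A_{c_0})$ and $\Pr\{\hat N=N\}\le p$; (ii) there are $c_2>0$ and $p<1$ such that for every $C>0$, all large $T$ and every measurable estimator $\{\hat\eta_1<\dots<\hat\eta_{\hat N}\}$ of the set of change points, some signal with $\lambda\ge2$ satisfies $(\mathrm A_{C})$ and $\Pr\{\hat N=N,\ \max_{1\le i\le N}\delta_i^2|\hat\eta_i-\eta_i|\le c_2\log T\}\le p$. -/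

import Mathlib

noncomputable section

namespace SeededBS

/-- The time points `1, …, T`. -/
abbrev Obs (T : ℕ) : Type := {t : ℕ // t ∈ Finset.Icc 1 T}

/-- The law of `(X_1, …, X_T)` where `X_t = f_t + ε_t` with `ε_t` i.i.d. standard Gaussian:
the product of the laws `N(f_t, 1)`. -/
def law (T : ℕ) (f : ℕ → ℝ) : MeasureTheory.Measure (Obs T → ℝ) :=
  MeasureTheory.Measure.pi fun t => ProbabilityTheory.gaussianReal (f t.1) 1

/-! ### The signal -/

open Classical in
/-- The change points of the signal `f_1, …, f_T`. -/
def changePoints (T : ℕ) (f : ℕ → ℝ) : Finset ℕ :=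
  (Finset.Ico 1 T).filter fun t => f (t + 1) ≠ f t

/-- The number `N` of change points. -/
def numChanges (T : ℕ) (f : ℕ → ℝ) : ℕ := (changePoints T f).card

/-- For a finite set `S` of locations, `loc T S 0 = 0`, `loc T S i` is the `i`-th smallest element
of `S` for `1 ≤ i ≤ #S`, and `loc T S (#S + 1) = T`. -/
def loc (T : ℕ) (S : Finset ℕ) : ℕ → ℕ
  | 0 => 0
  | i + 1 => (S.sort (· ≤ ·)).getD i T

/-- `η_i`, including `η_0 = 0` and `η_{N+1} = T`. -/
def eta (T : ℕ) (f : ℕ → ℝ) (i : ℕ) : ℕ := loc T (changePoints T f) i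

/-- The jump size `δ_i` at the `i`-th change point, `1 ≤ i ≤ N`. -/
def jump (T : ℕ) (f : ℕ → ℝ) (i : ℕ) : ℝ := |f (eta T f i + 1) - f (eta T f i)|

/-- The minimal jump `δ_*` (only used for `N > 0`). -/
def minJump (T : ℕ) (f : ℕ → ℝ) : ℝ := ⨅ i : Fin (numChanges T f), jump T f (i.1 + 1)

/-- The minimal spacing `λ`, over `i = 0, …, N`. -/
def minSpacing (T : ℕ) (f : ℕ → ℝ) : ℕ :=
  (Finset.range (numChanges T f + 1)).inf' ⟨0, by simp⟩ fun i => eta T f (i + 1) - eta T f i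

/-- `δ_*² λ ≥ C log T` (no condition if there is no change point). -/
def Detectable (C : ℝ) (T : ℕ) (f : ℕ → ℝ) : Prop :=
  0 < numChanges T f → C * Real.log T ≤ minJump T f ^ 2 * (minSpacing T f : ℝ)

/-- The set `S` of estimates has the right cardinality, and `δ_i² |η̂_i - η_i| ≤ B` for
`i = 1, …, N`. -/
def Accurate (T : ℕ) (f : ℕ → ℝ) (S : Finset ℕ) (B : ℝ) : Prop :=
  S.card = numChanges T f ∧
    ∀ i ∈ Finset.Icc 1 (numChanges T f),
      jump T f i ^ 2 * |(loc T S i : ℝ) - (eta T f i : ℝ)| ≤ B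

/-! ### Seeded intervals; the pair `(l, r)` stands for the interval `(l, r]` -/

/-- The number `n_k` of intervals in the `k`-th layer. -/
def layerCount (a : ℝ) (k : ℕ) : ℕ := 2 * ⌈(1 / a) ^ (k - 1)⌉₊ - 1

/-- The length `l_k`. -/
def layerLength (a : ℝ) (T k : ℕ) : ℝ := (T : ℝ) * a ^ (k - 1)

/-- The shift `s_k` (irrelevant for `k = 1`, where there is a single interval). -/
def layerShift (a : ℝ) (T k : ℕ) : ℝ :=
  ((T : ℝ) - layerLength a T k) / ((layerCount a k : ℝ) - 1)

/-- The `k`-th layer. -/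
def layer (a : ℝ) (T k : ℕ) : Finset (ℕ × ℕ) :=
  (Finset.Icc 1 (layerCount a k)).image fun i : ℕ =>
    (⌊((i : ℝ) - 1) * layerShift a T k⌋₊,
      ⌈((i : ℝ) - 1) * layerShift a T k + layerLength a T k⌉₊)

/-- The collection of all seeded intervals with decay `a`. -/
def seededIntervals (a : ℝ) (T : ℕ) : Finset (ℕ × ℕ) :=
  (Finset.Icc 1 ⌈Real.logb (1 / a) T⌉₊).biUnion fun k => layer a T k

/-! ### CUSUM statistics and narrowest-over-threshold selection -/

/-- The CUSUM statistic of the interval `(I.1, I.2]` at the split point `s`. -/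
def cusum {T : ℕ} (x : Obs T → ℝ) (I : ℕ × ℕ) (s : ℕ) : ℝ :=
  √(((I.2 : ℝ) - s) / (((I.2 : ℝ) - I.1) * ((s : ℝ) - I.1))) *
      (∑ t : Obs T with I.1 < t.1 ∧ t.1 ≤ s, x t) -
    √(((s : ℝ) - I.1) / (((I.2 : ℝ) - I.1) * ((I.2 : ℝ) - s))) *
      (∑ t : Obs T with s < t.1 ∧ t.1 ≤ I.2, x t)

/-- `s` maximises the absolute CUSUM statistic over `I.1 + 1, …, I.2 - 1`. -/
def IsBestSplit {T : ℕ} (x : Obs T → ℝ) (I : ℕ × ℕ) (s : ℕ) : Prop :=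
  s ∈ Finset.Ioo I.1 I.2 ∧ ∀ s' ∈ Finset.Ioo I.1 I.2, |cusum x I s'| ≤ |cusum x I s|

/-- The maximal absolute CUSUM statistic of the interval exceeds `κ`. -/
def OverThreshold {T : ℕ} (κ : ℝ) (x : Obs T → ℝ) (I : ℕ × ℕ) : Prop :=
  ∃ s, IsBestSplit x I s ∧ κ < |cusum x I s|

/-- `NarrowestRun x A S`: starting from the set `A` of active intervals, repeatedly picking a
narrowest active interval, recording a best split of it and discarding all active intervals that
contain this split can result in the set `S` of recorded points. Ties are broken arbitrarily. -/
inductive NarrowestRun {T : ℕ} (x : Obs T → ℝ) : Finset (ℕ × ℕ) → Finset ℕ → Prop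
  | done : NarrowestRun x ∅ ∅
  | step (A : Finset (ℕ × ℕ)) (I : ℕ × ℕ) (s : ℕ) (S : Finset ℕ)
      (hI : I ∈ A) (hmin : ∀ J ∈ A, I.2 - I.1 ≤ J.2 - J.1) (hs : IsBestSplit x I s)
      (hrun : NarrowestRun x (A.filter fun J => ¬ (J.1 < s ∧ s ≤ J.2)) S) :
      NarrowestRun x A (insert s S)

open Classical in
/-- `S` is a possible set of estimated change points of seeded binary segmentation with decay `a`,
minimal segment length `m` and narrowest-over-threshold selection with threshold `κ`. -/
def IsOutput {T : ℕ} (a : ℝ) (m : ℕ) (κ : ℝ) (x : Obs T → ℝ) (S : Finset ℕ) : Prop :=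
  NarrowestRun x
    ((seededIntervals a T).filter fun I => m ≤ I.2 - I.1 ∧ OverThreshold κ x I) S

/-- The procedure always produces an output. -/
theorem exists_isOutput {T : ℕ} (a : ℝ) (m : ℕ) (κ : ℝ) (x : Obs T → ℝ) :
    ∃ S, IsOutput a m κ x S := by
  classical
  have key : ∀ n : ℕ, ∀ A : Finset (ℕ × ℕ), A.card = n →
      (∀ I ∈ A, ∃ s, IsBestSplit x I s) → ∃ S, NarrowestRun x A S := by
    intro n
    induction n using Nat.strong_induction_on with
    | _ n ih =>
      intro A hA hb
      rcases A.eq_empty_or_nonempty with rfl | hne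
      · exact ⟨∅, .done⟩
      · obtain ⟨I, hI, hmin⟩ := A.exists_min_image (fun J => J.2 - J.1) hne
        obtain ⟨s, hs⟩ := hb I hI
        have hlt : (A.filter fun J => ¬ (J.1 < s ∧ s ≤ J.2)).card < n := by
          rw [← hA]
          apply Finset.card_lt_card
          rw [Finset.filter_ssubset]
          have := Finset.mem_Ioo.1 hs.1
          exact ⟨I, hI, not_not.2 ⟨this.1, this.2.le⟩⟩
        obtain ⟨S, hS⟩ := ih _ hlt _ rfl fun J hJ => hb J (Finset.mem_filter.1 hJ).1
        exact ⟨insert s S, .step A I s S hI hmin hs hS⟩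
  refine key _ _ rfl fun I hI => ?_
  obtain ⟨s, hs, -⟩ := (Finset.mem_filter.1 hI).2.2
  exact ⟨s, hs⟩

end SeededBS

end

open SeededBS Filter

namespace SeededBS

/-! ### Ordered locations, spacings and jumps -/

/-! Part 1 is deterministic on one event. With M = 3√(log T), a union bound over at most (T + 1)²
blocks shows that, outside an event of probability at most 8/T, every noise block sum is at most M
times the root of the block length (`NoiseBounded`). The threshold is 10M, and the signal condition
reads δ²λ ≥ 2304 M² for every jump δ, where λ is the minimal spacing. Call z accurate for a change η
with jump δ if δ²|z - η| ≤ 24 M²; then |z - η| ≤ λ/16.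

Three facts hold on the event. Every change has a seeded interval of length at most λ + 1, with at
least λ/8 on both sides, that is over the threshold and contains no accurate estimate of another
change (`exists_overThreshold_around`). If every change inside an interval has an accurate estimate
outside it, the signal there is within 7M of a constant in ℓ², so the interval is not over the
threshold (`abs_cusum_le_of_changes_near_boundary`). In an interval of length at most λ + 1 with a
change inside, a best split over the threshold is accurate (`localised_of_narrow`). Hence a selected
interval always contains an undetected change; the good interval of that change is still active, so
the narrowest one is short and its split is accurate. Induction along the run gives one accurate
estimate per change (`narrowestRun_spec`).

The sharp rate in the third fact comes from comparing the contrasts at the best split and at the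
change: if ρ is the inner product of the two unit contrast vectors, the signal loss is proportional
to 1 - ρ but the noise difference only to √(1 - ρ).

Part 2 is a second moment argument (`exists_law_le_add_half`). For n perturbations of f with
disjoint supports and energy at most v, the centred likelihood ratios are orthogonal with second
moments at most e^v, so no event separates f from all of them when e^v ≤ n/4. With v = (log T)/2 and
n of order T this applies to bumps of length two against zero, and to a long staircase against its
copies with one step shifted by one. -/

theorem loc_succ {T : ℕ} {S : Finset ℕ} (i : Fin S.card) :
    loc T S (i + 1) = S.orderEmbOfFin rfl i := by
  have hi : (i : ℕ) < (S.sort (· ≤ ·)).length := by simp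
  simp only [loc, Finset.orderEmbOfFin_apply]
  rw [List.getD_eq_getElem _ _ hi]
  rfl

theorem loc_succ_mem {T : ℕ} {S : Finset ℕ} {i : ℕ} (hi : i < S.card) : loc T S (i + 1) ∈ S := by
  rw [loc_succ ⟨i, hi⟩]
  exact Finset.orderEmbOfFin_mem _ _ _

theorem loc_card_succ {T : ℕ} {S : Finset ℕ} : loc T S (S.card + 1) = T := by
  simp [loc]

theorem exists_loc_eq {T : ℕ} {S : Finset ℕ} {x : ℕ} (hx : x ∈ S) :
    ∃ i < S.card, loc T S (i + 1) = x := by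
  have : x ∈ Set.range (S.orderEmbOfFin rfl) := by simpa using hx
  obtain ⟨i, rfl⟩ := this
  exact ⟨i, i.2, loc_succ i⟩

theorem loc_eq_of_strictMono {T : ℕ} {S : Finset ℕ} {n : ℕ} (hS : S.card = n) (g : Fin n → ℕ)
    (hg : StrictMono g) (hmem : ∀ i, g i ∈ S) (i : Fin n) : loc T S (i + 1) = g i := by
  subst hS
  rw [loc_succ, ← Finset.orderEmbOfFin_unique rfl hmem hg]

theorem loc_lt_loc {T : ℕ} {S : Finset ℕ} {i j : ℕ} (hij : i < j) (hj : j < S.card) :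
    loc T S (i + 1) < loc T S (j + 1) := by
  rw [loc_succ ⟨i, hij.trans hj⟩, loc_succ ⟨j, hj⟩]
  exact (S.orderEmbOfFin rfl).strictMono hij

/-- A strictly increasing relocation of the points of a finite set preserves the ranks. -/
theorem loc_image {T : ℕ} {S : Finset ℕ} {σ : ℕ → ℕ} (hσ : StrictMonoOn σ S) {i : ℕ}
    (hi : i < S.card) : loc T (S.image σ) (i + 1) = σ (loc T S (i + 1)) := by
  have hc : (S.image σ).card = S.card := Finset.card_image_of_injOn hσ.injOn
  rw [loc_eq_of_strictMono hc (fun j => σ (loc T S (j + 1))) _ _ ⟨i, hi⟩]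
  · intro j k hjk
    exact hσ (loc_succ_mem j.2) (loc_succ_mem k.2) (loc_lt_loc hjk k.2)
  · intro j
    exact Finset.mem_image_of_mem _ (loc_succ_mem j.2)

theorem mem_changePoints {T : ℕ} {f : ℕ → ℝ} {t : ℕ} :
    t ∈ changePoints T f ↔ (1 ≤ t ∧ t < T) ∧ f (t + 1) ≠ f t := by
  simp [changePoints]

theorem eta_succ_mem {T : ℕ} {f : ℕ → ℝ} {i : ℕ} (hi : i < numChanges T f) :
    eta T f (i + 1) ∈ changePoints T f := loc_succ_mem hi

theorem minSpacing_le {T : ℕ} {f : ℕ → ℝ} {i : ℕ} (hi : i ≤ numChanges T f) :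
    minSpacing T f ≤ eta T f (i + 1) - eta T f i :=
  Finset.inf'_le _ (by simpa using Nat.lt_succ_of_le hi)

theorem le_minSpacing {T : ℕ} {f : ℕ → ℝ} {k : ℕ} (hT : k ≤ T)
    (h : ∀ x ∈ changePoints T f, k ≤ x ∧ x + k ≤ T)
    (hp : ∀ x ∈ changePoints T f, ∀ y ∈ changePoints T f, x < y → x + k ≤ y) :
    k ≤ minSpacing T f := by
  refine Finset.le_inf' _ _ fun i hi => ?_
  have hi' : i ≤ numChanges T f := Nat.lt_succ_iff.1 (Finset.mem_range.1 hi)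
  rcases Nat.eq_zero_or_pos i with rfl | hpos
  · rcases hi'.eq_or_lt with h0 | h0
    · have : eta T f (0 + 1) = T := by
        have := loc_card_succ (T := T) (S := changePoints T f)
        rw [eta]; rw [numChanges] at h0; rw [← h0] at this; exact this
      rw [this]; simpa [eta, loc] using hT
    · have := (h _ (eta_succ_mem h0)).1
      simpa [eta, loc] using this
  · obtain ⟨j, rfl⟩ : ∃ j, i = j + 1 := ⟨i - 1, by omega⟩
    rcases hi'.eq_or_lt with h0 | h0
    · have h1 : eta T f (j + 1 + 1) = T := by
        have := loc_card_succ (T := T) (S := changePoints T f)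
        rw [eta]; rw [numChanges] at h0; rw [← h0] at this; exact this
      have := (h _ (eta_succ_mem (i := j) (by omega))).2
      omega
    · have := hp _ (eta_succ_mem (i := j) (by omega)) _ (eta_succ_mem h0)
        (loc_lt_loc (Nat.lt_succ_self j) h0)
      omega

/-- Needed because the gaps in `minSpacing` are truncated differences of natural numbers;
monotonicity makes them true differences. -/
theorem eta_le_eta {T : ℕ} {f : ℕ → ℝ} {i : ℕ} (hi : i ≤ numChanges T f) :
    eta T f i ≤ eta T f (i + 1) := by
  rcases Nat.eq_zero_or_pos i with rfl | hpos
  · simp [eta, loc]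
  · obtain ⟨j, rfl⟩ : ∃ j, i = j + 1 := ⟨i - 1, by omega⟩
    rcases hi.eq_or_lt with h0 | h0
    · have h1 : eta T f (j + 1 + 1) = T := by
        have := loc_card_succ (T := T) (S := changePoints T f)
        rw [eta]; rw [numChanges] at h0; rw [← h0] at this; exact this
      have := (mem_changePoints.1 (eta_succ_mem (T := T) (f := f) (i := j) (by omega))).1
      omega
    · exact (loc_lt_loc (Nat.lt_succ_self j) h0).le

theorem eta_mono {T : ℕ} {f : ℕ → ℝ} {i j : ℕ} (hij : i ≤ j) (hj : j ≤ numChanges T f + 1) :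
    eta T f i ≤ eta T f j := by
  induction j, hij using Nat.le_induction with
  | base => exact le_rfl
  | succ n hn ih => exact (ih (by omega)).trans (eta_le_eta (by omega))

theorem minSpacing_spec {T : ℕ} {f : ℕ → ℝ} {x : ℕ} (hx : x ∈ changePoints T f) :
    minSpacing T f ≤ x ∧ x + minSpacing T f ≤ T := by
  obtain ⟨i, hi, hix⟩ := exists_loc_eq (T := T) hx
  change i < numChanges T f at hi
  change eta T f (i + 1) = x at hix
  constructor
  · have h1 := minSpacing_le (T := T) (f := f) (i := i) hi.le
    omega
  · have h1 := minSpacing_le (T := T) (f := f) (i := i + 1) hi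
    have h2 : eta T f (i + 1 + 1) ≤ T := by
      have := eta_mono (T := T) (f := f) (i := i + 1 + 1) (j := numChanges T f + 1)
        (by omega) le_rfl
      have h3 : eta T f (numChanges T f + 1) = T := loc_card_succ
      omega
    have h3 := eta_le_eta (T := T) (f := f) (i := i + 1) hi
    omega

theorem add_minSpacing_le {T : ℕ} {f : ℕ → ℝ} {x y : ℕ} (hx : x ∈ changePoints T f)
    (hy : y ∈ changePoints T f) (hxy : x < y) : x + minSpacing T f ≤ y := by
  obtain ⟨i, hi, hix⟩ := exists_loc_eq (T := T) hx
  obtain ⟨j, hj, hjy⟩ := exists_loc_eq (T := T) hy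
  change i < numChanges T f at hi
  change j < numChanges T f at hj
  change eta T f (i + 1) = x at hix
  change eta T f (j + 1) = y at hjy
  have hij : i < j := by
    by_contra hji
    have := eta_mono (T := T) (f := f) (i := j + 1) (j := i + 1) (by omega) (by omega)
    omega
  have h1 := minSpacing_le (T := T) (f := f) (i := i + 1) hi
  have h2 := eta_mono (T := T) (f := f) (i := i + 1 + 1) (j := j + 1) (by omega) (by omega)
  have h3 := eta_le_eta (T := T) (f := f) (i := i + 1) hi
  omega

theorem minJump_nonneg {T : ℕ} {f : ℕ → ℝ} : 0 ≤ minJump T f :=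
  Real.iInf_nonneg fun _ => abs_nonneg _

theorem minJump_le {T : ℕ} {f : ℕ → ℝ} {x : ℕ} (hx : x ∈ changePoints T f) :
    minJump T f ≤ |f (x + 1) - f x| := by
  obtain ⟨i, hi, hix⟩ := exists_loc_eq (T := T) hx
  have := ciInf_le (f := fun i : Fin (numChanges T f) => jump T f (i.1 + 1))
    (Set.finite_range _).bddBelow ⟨i, hi⟩
  refine this.trans_eq ?_
  change eta T f (i + 1) = x at hix
  simp [jump, hix]

theorem le_minJump {T : ℕ} {f : ℕ → ℝ} {c : ℝ} (hN : 0 < numChanges T f)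
    (h : ∀ x ∈ changePoints T f, c ≤ |f (x + 1) - f x|) : c ≤ minJump T f := by
  have : Nonempty (Fin (numChanges T f)) := ⟨⟨0, hN⟩⟩
  exact le_ciInf fun i => h _ (eta_succ_mem i.2)

theorem Detectable.le_jump_sq {C : ℝ} {T : ℕ} {f : ℕ → ℝ} (h : Detectable C T f) {x : ℕ}
    (hx : x ∈ changePoints T f) :
    C * Real.log T ≤ (f (x + 1) - f x) ^ 2 * (minSpacing T f : ℝ) := by
  have h1 := h (Finset.card_pos.2 ⟨x, hx⟩)
  refine h1.trans (mul_le_mul_of_nonneg_right ?_ (Nat.cast_nonneg _))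
  rw [← sq_abs (f (x + 1) - f x)]
  exact pow_le_pow_left₀ minJump_nonneg (minJump_le hx) 2

theorem detectable_of_forall_jump {C δ : ℝ} {T k : ℕ} {f : ℕ → ℝ} (hδ : 0 ≤ δ)
    (h : ∀ x ∈ changePoints T f, δ ≤ |f (x + 1) - f x|) (hk : k ≤ minSpacing T f)
    (hC : C * Real.log T ≤ δ ^ 2 * k) : Detectable C T f := by
  intro hN
  refine hC.trans ?_
  have h1 := le_minJump hN h
  have h2 : (k : ℝ) ≤ minSpacing T f := by exact_mod_cast hk
  gcongr

/-- The signal is constant between consecutive change points. -/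
theorem eq_of_no_changePoint {T : ℕ} {f : ℕ → ℝ} {s t : ℕ} (hs : 1 ≤ s) (hst : s ≤ t) (ht : t ≤ T)
    (h : ∀ x ∈ changePoints T f, s ≤ x → t ≤ x) : f t = f s := by
  induction t, hst using Nat.le_induction with
  | base => rfl
  | succ n hn ih =>
    rw [← ih (by omega) fun x hx hsx => by have := h x hx hsx; omega]
    by_contra hne
    have := h n (mem_changePoints.2 ⟨⟨by omega, by omega⟩, hne⟩) hn
    omega

/-- Estimates that stay closer than half the minimal spacing are matched in order. -/
theorem accurate_image {T : ℕ} {f : ℕ → ℝ} {B : ℝ} {σ : ℕ → ℕ}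
    (hclose : ∀ x ∈ changePoints T f, 2 * |(σ x : ℝ) - x| < minSpacing T f)
    (hacc : ∀ x ∈ changePoints T f, (f (x + 1) - f x) ^ 2 * |(σ x : ℝ) - x| ≤ B) :
    Accurate T f ((changePoints T f).image σ) B := by
  have hmono : StrictMonoOn σ (changePoints T f) := by
    intro x hx y hy hxy
    have h1 := hclose x hx
    have h2 := hclose y hy
    have h3 : (x : ℝ) + minSpacing T f ≤ y := by exact_mod_cast add_minSpacing_le hx hy hxy
    have h4 := le_abs_self ((σ x : ℝ) - x)
    have h5 := neg_abs_le ((σ y : ℝ) - y)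
    have : (σ x : ℝ) < σ y := by linarith
    exact_mod_cast this
  refine ⟨Finset.card_image_of_injOn hmono.injOn, fun i hi => ?_⟩
  rw [Finset.mem_Icc] at hi
  obtain ⟨j, rfl⟩ : ∃ j, i = j + 1 := ⟨i - 1, by omega⟩
  have hj : j < numChanges T f := by omega
  rw [loc_image hmono hj, jump, sq_abs]
  exact hacc _ (eta_succ_mem hj)

/-! ### CUSUM statistics as contrasts of two block sums -/

/-- The CUSUM contrast of two adjacent blocks of lengths `A`, `R` with sums `x`, `y`. -/
noncomputable def contrast (A R x y : ℝ) : ℝ :=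
  √(R / ((A + R) * A)) * x - √(A / ((A + R) * R)) * y

/-- Rewritten through block means, the contrast visibly annihilates constants and is the inner
product of the data with a unit vector. -/
theorem contrast_eq {A R : ℝ} (hA : 0 < A) (hR : 0 < R) (x y : ℝ) :
    contrast A R x y = √(A * R / (A + R)) * (x / A - y / R) := by
  have h1 : √(R / ((A + R) * A)) = √(A * R / (A + R)) / A := by
    rw [eq_div_iff hA.ne', ← Real.sqrt_mul_self hA.le, ← Real.sqrt_mul (by positivity),
      Real.sqrt_mul_self hA.le]
    congr 1; field_simp
  have h2 : √(A / ((A + R) * R)) = √(A * R / (A + R)) / R := by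
    rw [eq_div_iff hR.ne', ← Real.sqrt_mul_self hR.le, ← Real.sqrt_mul (by positivity),
      Real.sqrt_mul_self hR.le]
    congr 1; field_simp
  rw [contrast, h1, h2]; ring

theorem contrast_add (A R x y x' y' : ℝ) :
    contrast A R (x + x') (y + y') = contrast A R x y + contrast A R x' y' := by
  simp only [contrast]; ring

theorem contrast_swap (A R x y : ℝ) : contrast R A y x = -contrast A R x y := by
  simp only [contrast, add_comm R A]; ring

/-- The right side is the squared contrast plus (x + y)²/(A + R), the energy of the overall mean. -/
theorem contrast_sq_le {A R : ℝ} (hA : 0 < A) (hR : 0 < R) (x y : ℝ) :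
    contrast A R x y ^ 2 ≤ x ^ 2 / A + y ^ 2 / R := by
  rw [contrast_eq hA hR, mul_pow, Real.sq_sqrt (by positivity)]
  have : x ^ 2 / A + y ^ 2 / R - A * R / (A + R) * (x / A - y / R) ^ 2 =
      (x + y) ^ 2 / (A + R) := by
    field_simp; ring
  have h2 : 0 ≤ (x + y) ^ 2 / (A + R) := by positivity
  linarith

theorem sq_le_of_abs_le_mul_sqrt {M A x : ℝ} (hA : 0 ≤ A) (h : |x| ≤ M * √A) :
    x ^ 2 ≤ M ^ 2 * A := by
  have := pow_le_pow_left₀ (abs_nonneg x) h 2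
  rwa [sq_abs, mul_pow, Real.sq_sqrt hA] at this

theorem abs_contrast_noise_le {A R M x y : ℝ} (hA : 0 < A) (hR : 0 < R) (hM : 0 ≤ M)
    (hx : |x| ≤ M * √A) (hy : |y| ≤ M * √R) : |contrast A R x y| ≤ 3 / 2 * M := by
  refine abs_le_of_sq_le_sq ?_ (by positivity)
  refine (contrast_sq_le hA hR x y).trans ?_
  have h1 : x ^ 2 / A ≤ M ^ 2 := by
    rw [div_le_iff₀ hA]; exact sq_le_of_abs_le_mul_sqrt hA.le hx
  have h2 : y ^ 2 / R ≤ M ^ 2 := by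
    rw [div_le_iff₀ hR]; exact sq_le_of_abs_le_mul_sqrt hR.le hy
  nlinarith [sq_nonneg M]

/-- If the maximal contrast is attained away from the true change with similarity `ρ`, then the
loss of signal energy is of the order of the noise. -/
theorem energy_loss_le {Δ ρ M u v : ℝ} (hΔ : 0 ≤ Δ) (h0 : 0 ≤ ρ) (h1 : ρ ≤ 1) (hM : 0 ≤ M)
    (hu : |u| ≤ 3 / 2 * M) (huv : (u - v) ^ 2 ≤ 6 * M ^ 2 * (1 - ρ))
    (hmax : |Δ + v| ≤ |Δ * ρ + u|) (hbig : 10 * M < |Δ * ρ + u|) :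
    Δ ^ 2 * (1 - ρ ^ 2) ≤ 12 * M ^ 2 ∧ 24 * M ^ 2 < Δ ^ 2 := by
  have hu' := abs_le.1 hu
  have hp : 0 ≤ Δ * ρ := mul_nonneg hΔ h0
  -- As Δρ ≥ 0, a negative value would have modulus at most |u| ≤ 3M/2, below 10M.
  have hpos : 0 ≤ Δ * ρ + u := by
    by_contra hneg
    rw [abs_of_neg (not_le.1 hneg)] at hbig
    linarith
  rw [abs_of_nonneg hpos] at hmax hbig
  have hle : Δ * ρ ≤ Δ := by nlinarith
  have hΔM : 17 / 2 * M < Δ := by linarith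
  refine ⟨?_, by nlinarith⟩
  -- The signal lost at the other split must be made up by the noise difference. Squaring and using
  -- its bound cancels one factor 1 - ρ.
  have h3 : Δ * (1 - ρ) ≤ u - v := by have := le_abs_self (Δ + v); linarith
  have h4 : (Δ * (1 - ρ)) ^ 2 ≤ 6 * M ^ 2 * (1 - ρ) :=
    (pow_le_pow_left₀ (mul_nonneg hΔ (by linarith)) h3 2).trans huv
  rcases h1.eq_or_lt with rfl | hlt
  · simp; positivity
  · have h5 : Δ ^ 2 * (1 - ρ) ≤ 6 * M ^ 2 := by
      have : (Δ ^ 2 * (1 - ρ)) * (1 - ρ) ≤ 6 * M ^ 2 * (1 - ρ) := by nlinarith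
      exact le_of_mul_le_mul_right this (by linarith)
    have h6 : Δ ^ 2 * (1 - ρ ^ 2) = Δ ^ 2 * (1 - ρ) * (1 + ρ) := by ring
    rw [h6]
    nlinarith [sq_nonneg M]

theorem sq_add_three_le (a b c : ℝ) : (a + b + c) ^ 2 ≤ 3 * (a ^ 2 + b ^ 2 + c ^ 2) := by
  nlinarith [sq_nonneg (a - b), sq_nonneg (b - c), sq_nonneg (a - c)]

/-- Three consecutive blocks of lengths `A`, `B`, `D` carry the means `g`, `g`, `g'`. If the
contrast after the first block is maximal and large, then the middle block is short. -/
theorem jump_sq_mul_le_of_contrast {A B D g g' M eA eB eD : ℝ} (hA : 0 < A) (hB : 0 < B)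
    (hD : 0 < D) (hM : 0 ≤ M) (hgg : g' ≤ g)
    (heA : |eA| ≤ M * √A) (heB : |eB| ≤ M * √B) (heD : |eD| ≤ M * √D)
    (heBD : |eB + eD| ≤ M * √(B + D))
    (hmax : |contrast (A + B) D ((A + B) * g + (eA + eB)) (D * g' + eD)| ≤
      |contrast A (B + D) (A * g + eA) (B * g + D * g' + (eB + eD))|)
    (hbig : 10 * M < |contrast A (B + D) (A * g + eA) (B * g + D * g' + (eB + eD))|) :
    (g - g') ^ 2 * B ≤ 24 * M ^ 2 := by
  have hAB : 0 < A + B := by positivity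
  have hBD : 0 < B + D := by positivity
  set w₁ := √(A * (B + D) / (A + (B + D))) with hw₁
  set w₂ := √((A + B) * D / (A + B + D)) with hw₂
  have hw₁0 : 0 ≤ w₁ := Real.sqrt_nonneg _
  have hw₂0 : 0 ≤ w₂ := Real.sqrt_nonneg _
  have hw₁s : w₁ ^ 2 = A * (B + D) / (A + (B + D)) := Real.sq_sqrt (by positivity)
  have hw₂s : w₂ ^ 2 = (A + B) * D / (A + B + D) := Real.sq_sqrt (by positivity)
  -- The inner product of the unit contrast vectors that split after the first and after the second
  -- block.
  set ρ := w₁ * w₂ * (A + B + D) / ((A + B) * (B + D)) with hρ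
  have hρ0 : 0 ≤ ρ := by positivity
  have hρs : ρ ^ 2 = A * D / ((B + D) * (A + B)) := by
    rw [hρ, div_pow, mul_pow, mul_pow, hw₁s, hw₂s]; field_simp; ring
  have hρ1 : ρ ≤ 1 := by
    refine (sq_le_one_iff₀ hρ0).1 ?_
    rw [hρs, div_le_one (by positivity)]
    have : 0 ≤ B * (A + B + D) := by positivity
    linarith
  set Δ := w₂ * (g - g') with hΔ
  have hΔ0 : 0 ≤ Δ := mul_nonneg hw₂0 (by linarith)
  set u := contrast A (B + D) eA (eB + eD) with hu
  set v := contrast (A + B) D (eA + eB) eD with hv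
  have hc₁ : contrast A (B + D) (A * g + eA) (B * g + D * g' + (eB + eD)) = Δ * ρ + u := by
    rw [contrast_add, contrast_eq hA hBD]
    congr 1
    have : Δ * ρ = w₁ * (w₂ ^ 2 * (A + B + D) / ((A + B) * (B + D))) * (g - g') := by
      rw [hΔ, hρ]; ring
    rw [this, hw₂s, ← hw₁]
    field_simp; ring
  have hc₂ : contrast (A + B) D ((A + B) * g + (eA + eB)) (D * g' + eD) = Δ + v := by
    rw [contrast_add, contrast_eq hAB hD]
    congr 1
    rw [← hw₂, hΔ]
    field_simp
  rw [hc₁] at hmax hbig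
  rw [hc₂] at hmax
  have huv : (u - v) ^ 2 ≤ 6 * M ^ 2 * (1 - ρ) := by
    have e1 : u - v = (w₁ / A - w₂ / (A + B)) * eA + (-(w₁ / (B + D) + w₂ / (A + B))) * eB +
        (w₂ / D - w₁ / (B + D)) * eD := by
      rw [hu, hv, contrast_eq hA hBD, contrast_eq hAB hD, ← hw₁, ← hw₂]
      field_simp; ring
    -- The squared norm of the difference of two unit vectors with inner product ρ. The factor 3 of
    -- `sq_add_three_le`, for three blocks, turns 2 into the 6 of `huv`.
    have e2 : A * (w₁ / A - w₂ / (A + B)) ^ 2 + B * (-(w₁ / (B + D) + w₂ / (A + B))) ^ 2 +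
        D * (w₂ / D - w₁ / (B + D)) ^ 2 = 2 * (1 - ρ) := by
      have : A * (w₁ / A - w₂ / (A + B)) ^ 2 + B * (-(w₁ / (B + D) + w₂ / (A + B))) ^ 2 +
        D * (w₂ / D - w₁ / (B + D)) ^ 2 = w₁ ^ 2 * (1 / A + 1 / (B + D)) +
          w₂ ^ 2 * (1 / (A + B) + 1 / D) - 2 * ρ := by
        rw [hρ]; field_simp; ring
      rw [this, hw₁s, hw₂s]
      field_simp; ring
    rw [e1]
    refine (sq_add_three_le _ _ _).trans ?_
    simp only [mul_pow]
    have k1 := sq_le_of_abs_le_mul_sqrt hA.le heA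
    have k2 := sq_le_of_abs_le_mul_sqrt hB.le heB
    have k3 := sq_le_of_abs_le_mul_sqrt hD.le heD
    have j1 := mul_le_mul_of_nonneg_left k1 (sq_nonneg (w₁ / A - w₂ / (A + B)))
    have j2 := mul_le_mul_of_nonneg_left k2 (sq_nonneg (-(w₁ / (B + D) + w₂ / (A + B))))
    have j3 := mul_le_mul_of_nonneg_left k3 (sq_nonneg (w₂ / D - w₁ / (B + D)))
    have e3 : M ^ 2 * (A * (w₁ / A - w₂ / (A + B)) ^ 2 +
        B * (-(w₁ / (B + D) + w₂ / (A + B))) ^ 2 + D * (w₂ / D - w₁ / (B + D)) ^ 2) =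
        M ^ 2 * (2 * (1 - ρ)) := by rw [e2]
    linarith
  obtain ⟨k1, k2⟩ := energy_loss_le hΔ0 hρ0 hρ1 hM
    (abs_contrast_noise_le hA hBD hM heA heBD) huv hmax hbig
  have e4 : Δ ^ 2 * (1 - ρ ^ 2) = (g - g') ^ 2 * (B * D) / (B + D) := by
    rw [hΔ, mul_pow, hw₂s, hρs]; field_simp; ring
  have e5 : Δ ^ 2 ≤ (g - g') ^ 2 * D := by
    rw [hΔ, mul_pow, hw₂s, mul_comm]
    refine mul_le_mul_of_nonneg_left ?_ (sq_nonneg _)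
    rw [div_le_iff₀ (by positivity), mul_comm]
    exact mul_le_mul_of_nonneg_left (by linarith) hD.le
  rw [e4, div_le_iff₀ hBD] at k1
  -- The energy loss is (g - g')² BD/(B + D), at least half of (g - g')² min(B, D). If D were the
  -- smaller block, then Δ² ≤ (g - g')² D ≤ 24 M², contradicting the size of Δ.
  rcases le_total B D with h | h
  · refine le_of_mul_le_mul_right ?_ hD
    have := mul_le_mul_of_nonneg_left h (sq_nonneg M)
    linarith
  · exfalso
    have : (g - g') ^ 2 * D * B ≤ 24 * M ^ 2 * B := by
      have := mul_le_mul_of_nonneg_left h (sq_nonneg M)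
      linarith
    have := le_of_mul_le_mul_right this hB
    linarith

theorem jump_sq_mul_le_of_contrast' {A B D g g' M eA eB eD : ℝ} (hA : 0 < A) (hB : 0 < B)
    (hD : 0 < D) (hM : 0 ≤ M)
    (heA : |eA| ≤ M * √A) (heB : |eB| ≤ M * √B) (heD : |eD| ≤ M * √D)
    (heBD : |eB + eD| ≤ M * √(B + D))
    (hmax : |contrast (A + B) D ((A + B) * g + (eA + eB)) (D * g' + eD)| ≤
      |contrast A (B + D) (A * g + eA) (B * g + D * g' + (eB + eD))|)
    (hbig : 10 * M < |contrast A (B + D) (A * g + eA) (B * g + D * g' + (eB + eD))|) :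
    (g - g') ^ 2 * B ≤ 24 * M ^ 2 := by
  rcases le_total g' g with h | h
  · exact jump_sq_mul_le_of_contrast hA hB hD hM h heA heB heD heBD hmax hbig
  · have hneg : ∀ a b x y : ℝ, |contrast a b (-x) (-y)| = |contrast a b x y| := by
      intro a b x y
      rw [← abs_neg (contrast a b x y)]
      congr 1; simp only [contrast]; ring
    have := jump_sq_mul_le_of_contrast (g := -g) (g' := -g') (eA := -eA) (eB := -eB) (eD := -eD)
      (M := M) hA hB hD hM (by linarith) (by rwa [abs_neg]) (by rwa [abs_neg]) (by rwa [abs_neg])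
      (by rw [← neg_add, abs_neg]; exact heBD)
      (by
        rw [← hneg (A + B) D, ← hneg A (B + D)] at hmax
        convert hmax using 3 <;> ring)
      (by
        rw [← hneg A (B + D)] at hbig
        convert hbig using 3 <;> ring)
    convert this using 1; ring

/-- Sum of the observations in `(p, q]`. -/
noncomputable def blockSum {T : ℕ} (x : Obs T → ℝ) (p q : ℕ) : ℝ :=
  ∑ t : Obs T with p < t.1 ∧ t.1 ≤ q, x t

theorem blockSum_add {T : ℕ} (x y : Obs T → ℝ) (p q : ℕ) :
    blockSum (fun t => x t + y t) p q = blockSum x p q + blockSum y p q :=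
  Finset.sum_add_distrib

theorem blockSum_append {T : ℕ} (x : Obs T → ℝ) {p q r : ℕ} (hpq : p ≤ q) (hqr : q ≤ r) :
    blockSum x p q + blockSum x q r = blockSum x p r := by
  classical
  rw [blockSum, blockSum, blockSum, ← Finset.sum_union]
  · congr 1
    ext t
    simp only [Finset.mem_union, Finset.mem_filter, Finset.mem_univ, true_and]
    omega
  · rw [Finset.disjoint_left]
    intro t
    simp only [Finset.mem_filter, Finset.mem_univ, true_and]
    omega

theorem blockSum_coe {T : ℕ} (f : ℕ → ℝ) {p q : ℕ} (hq : q ≤ T) :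
    blockSum (fun t : Obs T => f t.1) p q = ∑ t ∈ Finset.Ioc p q, f t := by
  rw [blockSum]
  refine Finset.sum_bij (fun t _ => t.1) ?_ ?_ ?_ ?_
  · intro t ht
    simpa using ht
  · intro t _ t' _ h
    exact Subtype.ext h
  · intro t ht
    rw [Finset.mem_Ioc] at ht
    exact ⟨⟨t, Finset.mem_Icc.2 ⟨by omega, by omega⟩⟩, by simpa using ht, rfl⟩
  · intro t _; rfl

theorem blockSum_const {T : ℕ} {f : ℕ → ℝ} {p q : ℕ} {g : ℝ} (hpq : p ≤ q) (hq : q ≤ T)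
    (h : ∀ t, p < t → t ≤ q → f t = g) :
    blockSum (fun t : Obs T => f t.1) p q = ((q : ℝ) - p) * g := by
  have h' : ∀ t ∈ Finset.Ioc p q, f t = g := fun t ht =>
    h t (Finset.mem_Ioc.1 ht).1 (Finset.mem_Ioc.1 ht).2
  rw [blockSum_coe f hq, Finset.sum_congr rfl h']
  simp [Nat.cast_sub hpq]

theorem cusum_eq_contrast {T : ℕ} (x : Obs T → ℝ) (l r s : ℕ) :
    cusum x (l, r) s =
      contrast ((s : ℝ) - l) ((r : ℝ) - s) (blockSum x l s) (blockSum x s r) := by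
  simp only [cusum, contrast, blockSum]
  rw [show (s : ℝ) - l + (r - s) = r - l by ring]

/-- All normalised block sums of the noise are bounded by `M`. -/
def NoiseBounded (T : ℕ) (f : ℕ → ℝ) (M : ℝ) (x : Obs T → ℝ) : Prop :=
  ∀ p q : ℕ, p < q → q ≤ T → |blockSum (fun t => x t - f t.1) p q| ≤ M * √((q : ℝ) - p)

theorem blockSum_eq_signal_add {T : ℕ} (x : Obs T → ℝ) (f : ℕ → ℝ) (p q : ℕ) :
    blockSum x p q =
      blockSum (fun t : Obs T => f t.1) p q + blockSum (fun t => x t - f t.1) p q := by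
  rw [← blockSum_add]; congr 1; funext t; ring

theorem sq_blockSum_le {T : ℕ} (f : ℕ → ℝ) {p q : ℕ} (hpq : p < q) (hq : q ≤ T) :
    blockSum (fun t : Obs T => f t.1) p q ^ 2 / ((q : ℝ) - p) ≤
      ∑ t ∈ Finset.Ioc p q, f t ^ 2 := by
  have hpos : (0 : ℝ) < q - p := by
    rw [sub_pos]; exact_mod_cast hpq
  rw [div_le_iff₀ hpos, blockSum_coe f hq, mul_comm]
  have := sq_sum_le_card_mul_sum_sq (s := Finset.Ioc p q) (f := f)
  rwa [Nat.card_Ioc, Nat.cast_sub hpq.le] at this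

/-- A CUSUM statistic is bounded by the distance of the signal to a constant, up to noise. -/
theorem abs_cusum_le {T : ℕ} {f : ℕ → ℝ} {M : ℝ} {x : Obs T → ℝ} (hM : 0 ≤ M)
    (hx : NoiseBounded T f M x) {l s r : ℕ} (hls : l < s) (hsr : s < r) (hr : r ≤ T) (c : ℝ) :
    |cusum x (l, r) s| ≤ √(∑ t ∈ Finset.Ioc l r, (f t - c) ^ 2) + 3 / 2 * M := by
  have hA : (0 : ℝ) < s - l := by rw [sub_pos]; exact_mod_cast hls
  have hR : (0 : ℝ) < r - s := by rw [sub_pos]; exact_mod_cast hsr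
  have hdec : ∀ p q : ℕ, p ≤ q → q ≤ T → blockSum x p q =
      ((q : ℝ) - p) * c + (blockSum (fun t : Obs T => f t.1 - c) p q +
        blockSum (fun t => x t - f t.1) p q) := by
    intro p q hpq hq
    rw [← blockSum_add, ← blockSum_const (f := fun _ => c) hpq hq (fun _ _ _ => rfl),
      ← blockSum_add]
    congr 1; funext t; ring
  have h0 : contrast ((s : ℝ) - l) ((r : ℝ) - s) (((s : ℝ) - l) * c) (((r : ℝ) - s) * c) = 0 := by
    rw [contrast_eq hA hR]; field_simp; ring
  rw [cusum_eq_contrast, hdec l s hls.le (by omega), hdec s r hsr.le hr, contrast_add, h0, zero_add,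
    contrast_add]
  refine (abs_add_le _ _).trans (add_le_add ?_ ?_)
  · refine Real.abs_le_sqrt ((contrast_sq_le hA hR _ _).trans ?_)
    refine (add_le_add (sq_blockSum_le (fun t => f t - c) hls (by omega))
      (sq_blockSum_le (fun t => f t - c) hsr hr)).trans_eq ?_
    rw [← Finset.Ioc_union_Ioc_eq_Ioc hls.le hsr.le, Finset.sum_union]
    rw [Finset.disjoint_left]
    intro t
    simp only [Finset.mem_Ioc]
    omega
  · exact abs_contrast_noise_le hA hR hM (hx l s hls (by omega)) (hx s r hsr hr)

/-- Lower bound on the CUSUM statistic at an isolated change. -/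
theorem le_abs_cusum {T : ℕ} {f : ℕ → ℝ} {M : ℝ} {x : Obs T → ℝ} (hM : 0 ≤ M)
    (hx : NoiseBounded T f M x) {l s r : ℕ} (hls : l < s) (hsr : s < r) (hr : r ≤ T) {g g' : ℝ}
    (hg : ∀ t, l < t → t ≤ s → f t = g) (hg' : ∀ t, s < t → t ≤ r → f t = g') :
    √(((s : ℝ) - l) * (r - s) / (r - l)) * |g - g'| - 3 / 2 * M ≤ |cusum x (l, r) s| := by
  have hA : (0 : ℝ) < s - l := by rw [sub_pos]; exact_mod_cast hls
  have hR : (0 : ℝ) < r - s := by rw [sub_pos]; exact_mod_cast hsr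
  rw [cusum_eq_contrast, blockSum_eq_signal_add x f l s, blockSum_eq_signal_add x f s r,
    contrast_add, blockSum_const hls.le (by omega) hg, blockSum_const hsr.le hr hg',
    contrast_eq hA hR, mul_div_cancel_left₀ _ hA.ne', mul_div_cancel_left₀ _ hR.ne',
    show (s : ℝ) - l + (r - s) = r - l by ring]
  have h1 := abs_contrast_noise_le hA hR hM (hx l s hls (by omega)) (hx s r hsr hr)
  have h2 : |√(((s : ℝ) - l) * (r - s) / (r - l)) * (g - g')| =
      √(((s : ℝ) - l) * (r - s) / (r - l)) * |g - g'| := by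
    rw [abs_mul, abs_of_nonneg (Real.sqrt_nonneg _)]
  rw [← h2]
  set u := √(((s : ℝ) - l) * (r - s) / (r - l)) * (g - g')
  set v := contrast ((s : ℝ) - l) (r - s) (blockSum (fun t => x t - f t.1) l s)
    (blockSum (fun t => x t - f t.1) s r)
  have := abs_sub_abs_le_abs_sub u (-v)
  rw [sub_neg_eq_add, abs_neg] at this
  linarith

/-- Localisation: in an interval with a single change `η`, a best split with a large CUSUM statistic
is close to `η`. -/
theorem jump_sq_mul_dist_le {T : ℕ} {f : ℕ → ℝ} {M : ℝ} {x : Obs T → ℝ} (hM : 0 ≤ M)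
    (hx : NoiseBounded T f M x) {l η r s : ℕ} (hlη : l < η) (hηr : η < r) (hr : r ≤ T) {g g' : ℝ}
    (hg : ∀ t, l < t → t ≤ η → f t = g) (hg' : ∀ t, η < t → t ≤ r → f t = g')
    (hs : IsBestSplit x (l, r) s) (hbig : 10 * M < |cusum x (l, r) s|) :
    (g - g') ^ 2 * |(s : ℝ) - η| ≤ 24 * M ^ 2 := by
  have hmax := hs.2 η (Finset.mem_Ioo.2 ⟨hlη, hηr⟩)
  obtain ⟨hls, hsr⟩ := Finset.mem_Ioo.1 hs.1
  simp only at hls hsr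
  rcases lt_trichotomy s η with h | h | h
  · have hA : (0 : ℝ) < s - l := by rw [sub_pos]; exact_mod_cast hls
    have hB : (0 : ℝ) < η - s := by rw [sub_pos]; exact_mod_cast h
    have hD : (0 : ℝ) < r - η := by rw [sub_pos]; exact_mod_cast hηr
    have hBD := hx s r hsr hr
    have hη := cusum_eq_contrast x l r η
    have hsc := cusum_eq_contrast x l r s
    rw [← blockSum_append _ hls.le h.le] at hη
    rw [← blockSum_append _ h.le hηr.le] at hsc hBD
    rw [blockSum_eq_signal_add x f l s, blockSum_eq_signal_add x f s η,
      blockSum_eq_signal_add x f η r,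
      blockSum_const hls.le (by omega) (fun t h1 h2 => hg t h1 (by omega)),
      blockSum_const h.le (by omega) (fun t h1 h2 => hg t (by omega) h2),
      blockSum_const hηr.le hr hg'] at hη hsc
    rw [abs_of_neg (by linarith), neg_sub]
    refine jump_sq_mul_le_of_contrast' hA hB hD hM (hx l s hls (by omega)) (hx s η h (by omega))
      (hx η r hηr hr) (by convert hBD using 3; ring) ?_ ?_
    · rw [hη, hsc] at hmax
      convert hmax using 3 <;> ring
    · rw [hsc] at hbig
      convert hbig using 3 <;> ring
  · subst h
    simp; positivity
  · have hA : (0 : ℝ) < η - l := by rw [sub_pos]; exact_mod_cast hlη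
    have hB : (0 : ℝ) < s - η := by rw [sub_pos]; exact_mod_cast h
    have hD : (0 : ℝ) < r - s := by rw [sub_pos]; exact_mod_cast hsr
    have hBA := hx l s hls (by omega)
    have hη := cusum_eq_contrast x l r η
    have hsc := cusum_eq_contrast x l r s
    rw [← blockSum_append _ h.le hsr.le] at hη
    rw [← blockSum_append _ hlη.le h.le] at hsc hBA
    rw [blockSum_eq_signal_add x f l η, blockSum_eq_signal_add x f s r,
      blockSum_eq_signal_add x f η s,
      blockSum_const hlη.le (by omega) hg,
      blockSum_const h.le (by omega) (fun t h1 h2 => hg' t h1 (by omega)),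
      blockSum_const hsr.le hr (fun t h1 h2 => hg' t (by omega) h2)] at hη hsc
    -- Reading the interval from right to left reduces to the block configuration of the first case.
    rw [← neg_eq_iff_eq_neg.2 (contrast_swap _ _ _ _)] at hη hsc
    rw [abs_of_pos hB, ← neg_sub g', neg_sq]
    refine jump_sq_mul_le_of_contrast' hD hB hA hM (hx s r hsr hr) (hx η s h (by omega))
      (hx l η hlη (by omega)) (by rw [add_comm]; convert hBA using 3; ring) ?_ ?_
    · rw [hη, hsc, abs_neg, abs_neg] at hmax
      convert hmax using 3 <;> ring
    · rw [hsc, abs_neg] at hbig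
      convert hbig using 3 <;> ring

/-! ### Seeded intervals -/

theorem one_le_layerCount (a : ℝ) {k : ℕ} (ha : 0 < a) : 1 ≤ layerCount a k := by
  have : 0 < ⌈(1 / a) ^ (k - 1)⌉₊ := Nat.ceil_pos.2 (by positivity)
  rw [layerCount]; omega

theorem layerCount_sub_one (a : ℝ) {k : ℕ} (ha : 0 < a) :
    (layerCount a k : ℝ) - 1 = 2 * ((⌈(1 / a) ^ (k - 1)⌉₊ : ℝ) - 1) := by
  have h : 0 < ⌈(1 / a) ^ (k - 1)⌉₊ := Nat.ceil_pos.2 (by positivity)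
  have : layerCount a k + 1 = 2 * ⌈(1 / a) ^ (k - 1)⌉₊ := by rw [layerCount]; omega
  have : (layerCount a k : ℝ) + 1 = 2 * ⌈(1 / a) ^ (k - 1)⌉₊ := by exact_mod_cast this
  linarith

theorem layerLength_mul (a : ℝ) {T k : ℕ} (ha : 0 < a) :
    (T : ℝ) = layerLength a T k * (1 / a) ^ (k - 1) := by
  rw [layerLength, mul_assoc, ← mul_pow, mul_one_div_cancel ha.ne', one_pow, mul_one]

theorem one_lt_inv_pow {a : ℝ} {k : ℕ} (ha : 0 < a) (ha1 : a < 1) (hk : 2 ≤ k) :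
    1 < (1 / a) ^ (k - 1) :=
  one_lt_pow₀ ((one_lt_div ha).2 ha1) (by omega)

theorem layerCount_sub_one_pos {a : ℝ} {k : ℕ} (ha : 0 < a) (ha1 : a < 1) (hk : 2 ≤ k) :
    (0 : ℝ) < (layerCount a k : ℝ) - 1 := by
  rw [layerCount_sub_one a ha]
  have := (one_lt_inv_pow ha ha1 hk).trans_le (Nat.le_ceil _)
  linarith

theorem layerShift_nonneg {a : ℝ} {T k : ℕ} (ha : 0 < a) (ha1 : a < 1) (hk : 2 ≤ k) :
    0 ≤ layerShift a T k := by
  refine div_nonneg ?_ (layerCount_sub_one_pos ha ha1 hk).le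
  rw [layerLength, sub_nonneg]
  exact mul_le_of_le_one_right (Nat.cast_nonneg _) (pow_le_one₀ ha.le ha1.le)

/-- With c = (1/a)^(k-1) one has T - l_k = l_k (c - 1), while n_k - 1 = 2(⌈c⌉ - 1). -/
theorem layerShift_le {a : ℝ} {T k : ℕ} (ha : 0 < a) (ha1 : a < 1) (hk : 2 ≤ k) :
    layerShift a T k ≤ layerLength a T k / 2 := by
  rw [layerShift, div_le_iff₀ (layerCount_sub_one_pos ha ha1 hk), layerCount_sub_one a ha]
  have hL : 0 ≤ layerLength a T k := by rw [layerLength]; positivity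
  have h1 := Nat.le_ceil ((1 / a) ^ (k - 1))
  have h2 := layerLength_mul a (T := T) (k := k) ha
  have h3 := mul_le_mul_of_nonneg_left h1 hL
  linarith

theorem layer_right_end {a : ℝ} {T k : ℕ} (ha : 0 < a) (ha1 : a < 1) (hk : 2 ≤ k) :
    ((layerCount a k : ℝ) - 1) * layerShift a T k + layerLength a T k = T := by
  rw [layerShift, mul_div_cancel₀ _ (layerCount_sub_one_pos ha ha1 hk).ne']
  ring

/-- Seeded intervals are contained in `(0, T]`. -/
theorem right_le_of_mem_seededIntervals {a : ℝ} {T : ℕ} (ha : 0 < a) (ha1 : a < 1) {I : ℕ × ℕ}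
    (hI : I ∈ seededIntervals a T) : I.2 ≤ T := by
  simp only [seededIntervals, layer, Finset.mem_biUnion, Finset.mem_image, Finset.mem_Icc] at hI
  obtain ⟨k, ⟨hk, -⟩, i, ⟨hi1, hi2⟩, rfl⟩ := hI
  simp only
  refine Nat.ceil_le.2 ?_
  rcases hk.eq_or_lt with rfl | hk
  -- The first layer consists of i = 1 alone, so its shift, a division by zero, is multiplied by
  -- zero.
  · have : i = 1 := by
      simp [layerCount] at hi2; omega
    subst this
    simp [layerLength]
  · rw [← layer_right_end (T := T) ha ha1 hk]
    have h1 : (i : ℝ) ≤ layerCount a k := by exact_mod_cast hi2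
    have := mul_le_mul_of_nonneg_right (sub_le_sub_right h1 1)
      (layerShift_nonneg (T := T) ha ha1 hk)
    linarith

/-- The first layer whose length does not exceed `d`. -/
theorem exists_layer {a : ℝ} {T d : ℕ} (ha : 1 / 2 ≤ a) (ha1 : a < 1) (hd : 2 ≤ d) (hdT : d < T) :
    ∃ k, 2 ≤ k ∧ k ≤ ⌈Real.logb (1 / a) T⌉₊ ∧ a * d < layerLength a T k ∧
      layerLength a T k ≤ d := by
  classical
  have ha0 : 0 < a := by linarith
  have hT : (0 : ℝ) < T := by exact_mod_cast (by omega : 0 < T)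
  have hd' : (2 : ℝ) ≤ d := by exact_mod_cast hd
  have hex : ∃ j : ℕ, (T : ℝ) * a ^ j ≤ d := by
    obtain ⟨j, hj⟩ := exists_pow_lt_of_lt_one (x := (d : ℝ) / T) (by positivity) ha1
    rw [lt_div_iff₀ hT] at hj
    exact ⟨j, by linarith⟩
  obtain ⟨j, hj, hmin⟩ : ∃ j : ℕ, (T : ℝ) * a ^ j ≤ d ∧ ∀ i < j, ¬ (T : ℝ) * a ^ i ≤ d :=
    ⟨Nat.find hex, Nat.find_spec hex, fun i hi => Nat.find_min hex hi⟩
  have hj0 : j ≠ 0 := by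
    rintro rfl
    simp only [pow_zero, mul_one] at hj
    have : T ≤ d := by exact_mod_cast hj
    omega
  have hlow : a * d < T * a ^ j := by
    have h1 := not_le.1 (hmin (j - 1) (by omega))
    have h2 : a ^ j = a ^ (j - 1) * a := by rw [← pow_succ]; congr 1; omega
    rw [h2]
    have := mul_lt_mul_of_pos_left h1 ha0
    linarith
  refine ⟨j + 1, by omega, ?_, by simpa [layerLength] using hlow, by simpa [layerLength] using hj⟩
  -- The layer exists as soon as T a^j > 1, and T a^j > a d ≥ 1 because a ≥ 1/2 and d ≥ 2.
  refine Nat.lt_ceil.2 ?_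
  rw [Real.lt_logb_iff_rpow_lt ((one_lt_div ha0).2 ha1) hT, Real.rpow_natCast, one_div, inv_pow,
    inv_lt_iff_one_lt_mul₀ (by positivity), mul_comm]
  nlinarith

/-- The right end points (before rounding) in a layer leave no gap of more than half the length. -/
theorem exists_mem_layer {a : ℝ} {T k : ℕ} (ha : 0 < a) (ha1 : a < 1) (hk : 2 ≤ k) {A : ℝ}
    (hA : layerLength a T k / 2 ≤ A) (hAT : A < T) :
    ∃ e : ℝ, A < e ∧ e ≤ A + layerLength a T k / 2 ∧ layerLength a T k ≤ e ∧
      (⌊e - layerLength a T k⌋₊, ⌈e⌉₊) ∈ layer a T k := by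
  classical
  have hex : ∃ j : ℕ, A < j * layerShift a T k + layerLength a T k := by
    refine ⟨layerCount a k - 1, ?_⟩
    rw [Nat.cast_sub (one_le_layerCount a ha), Nat.cast_one, layer_right_end ha ha1 hk]
    exact hAT
  obtain ⟨j, hj, hmin⟩ : ∃ j : ℕ, A < j * layerShift a T k + layerLength a T k ∧
      ∀ i < j, ¬ A < i * layerShift a T k + layerLength a T k :=
    ⟨Nat.find hex, Nat.find_spec hex, fun i hi => Nat.find_min hex hi⟩
  have hs0 := layerShift_nonneg (T := T) ha ha1 hk
  have hs := layerShift_le (T := T) ha ha1 hk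
  refine ⟨j * layerShift a T k + layerLength a T k, hj, ?_, ?_, ?_⟩
  -- If already the first right end, which equals the layer length, exceeds A, there is no previous
  -- end to compare with; `hA` covers this case.
  · rcases Nat.eq_zero_or_pos j with rfl | hj0
    · simp only [Nat.cast_zero, zero_mul, zero_add]; linarith
    · have h1 := not_lt.1 (hmin (j - 1) (by omega))
      rw [Nat.cast_sub hj0, Nat.cast_one] at h1
      linarith
  · have : 0 ≤ (j : ℝ) * layerShift a T k := by positivity
    linarith
  · rw [layer, Finset.mem_image]
    refine ⟨j + 1, Finset.mem_Icc.2 ⟨by omega, ?_⟩, ?_⟩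
    · have := one_le_layerCount a (k := k) ha
      by_contra hlt
      refine hmin (layerCount a k - 1) (by omega) ?_
      rw [Nat.cast_sub (one_le_layerCount a ha), Nat.cast_one, layer_right_end ha ha1 hk]
      exact hAT
    · simp

/-- Around a point `η` that is isolated at distance `d` there is a seeded interval of length
comparable to `d` which is balanced around `η` and stays away from `η - d` and `η + d`. -/
theorem exists_seeded_around {a : ℝ} {T d η m : ℕ} (ha : 1 / 2 ≤ a) (ha1 : a < 1) (hd : 2 ≤ d)
    (h1 : d ≤ η) (h2 : η + d ≤ T) (hm : (m : ℝ) ≤ a * d + 1) :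
    ∃ l r : ℕ, (l, r) ∈ seededIntervals a T ∧ m ≤ r - l ∧ r ≤ l + d + 1 ∧ l < η ∧ η < r ∧
      d ≤ 8 * (η - l) ∧ d ≤ 8 * (r - η) ∧
      ∀ D : ℕ, 16 * D ≤ d → η + D ≤ l + d ∧ r + D < η + d := by
  have ha0 : 0 < a := by linarith
  obtain ⟨k, hk2, hkK, hlow, hup⟩ := exists_layer ha ha1 hd (show d < T by omega)
  set L := layerLength a T k with hL
  have hd' : (2 : ℝ) ≤ d := by exact_mod_cast hd
  have h1' : (d : ℝ) ≤ η := by exact_mod_cast h1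
  have h2' : (η : ℝ) + d ≤ T := by exact_mod_cast h2
  have hLd : (d : ℝ) / 2 < L := by nlinarith
  -- The right end is sought in (η + θL, η + θL + L/2]. The value θ = 1/4 leaves L/4 > d/8 on both
  -- sides of η. For d ≤ 3 rounding could then bring r up to η + d, so θ = 0 is taken; one
  -- observation on each side suffices there.
  obtain ⟨θ, hθ0, hθ⟩ : ∃ θ : ℝ, 0 ≤ θ ∧ ((d ≤ 3 ∧ θ = 0) ∨ (4 ≤ d ∧ θ = 1 / 4)) := by
    rcases le_or_gt d 3 with h | h
    · exact ⟨0, le_rfl, .inl ⟨h, rfl⟩⟩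
    · exact ⟨1 / 4, by norm_num, .inr ⟨h, rfl⟩⟩
  have hθ1 : θ ≤ 1 / 4 := by rcases hθ with ⟨-, h⟩ | ⟨-, h⟩ <;> rw [h]; norm_num
  have hθL : θ * L ≤ 1 / 4 * L := mul_le_mul_of_nonneg_right hθ1 (by linarith)
  have hθL0 : 0 ≤ θ * L := mul_nonneg hθ0 (by linarith)
  obtain ⟨e, he1, he2, he3, hmem⟩ := exists_mem_layer (T := T) ha0 ha1 hk2 (A := η + θ * L)
    (by linarith) (by linarith)
  rw [← hL] at he2 he3 hmem
  have hr1 := Nat.le_ceil e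
  have hr2 := Nat.ceil_lt_add_one (show 0 ≤ e by linarith)
  have hl1 := Nat.floor_le (show 0 ≤ e - L by linarith)
  have hl2 := Nat.lt_floor_add_one (e - L)
  set l := ⌊e - L⌋₊ with hl
  set r := ⌈e⌉₊ with hr
  have hlη : l < η := by
    have : (l : ℝ) < η := by linarith
    exact_mod_cast this
  have hηr : η < r := by
    have : (η : ℝ) < r := by linarith
    exact_mod_cast this
  refine ⟨l, r, ?_, ?_, ?_, hlη, hηr, ?_⟩
  · exact Finset.mem_biUnion.2 ⟨k, Finset.mem_Icc.2 ⟨by omega, hkK⟩, hmem⟩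
  -- Outward rounding gives r - l ≥ L > a d ≥ m - 1, hence r - l ≥ m by integrality. It adds less
  -- than 2 to L ≤ d, whence the bound d + 1 in the next item.
  · have : (m : ℝ) < r - l + 1 := by linarith
    have : m + l < r + 1 := by
      have : (m : ℝ) + l < r + 1 := by linarith
      exact_mod_cast this
    omega
  · have : (r : ℝ) < l + d + 2 := by linarith
    have : r < l + d + 2 := by exact_mod_cast this
    omega
  · rcases hθ with ⟨hd3, rfl⟩ | ⟨hd4, rfl⟩
    · refine ⟨by omega, by omega, fun D hD => ?_⟩
      have k1 : η ≤ l + d := by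
        have : η < l + 1 + d := by
          have : (η : ℝ) < l + 1 + d := by linarith
          exact_mod_cast this
        omega
      have k2 : 2 * r < 2 * η + d + 2 := by
        have : 2 * (r : ℝ) < 2 * η + d + 2 := by linarith
        exact_mod_cast this
      omega
    · have k1 : 8 * l + d ≤ 8 * η := by
        have : 8 * (l : ℝ) + d ≤ 8 * η := by linarith
        exact_mod_cast this
      have k2 : 8 * η + d ≤ 8 * r := by
        have : 8 * (η : ℝ) + d ≤ 8 * r := by linarith
        exact_mod_cast this
      have k3 : 4 * η < 4 * l + 4 + 3 * d := by
        have : 4 * (η : ℝ) < 4 * l + 4 + 3 * d := by linarith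
        exact_mod_cast this
      have k4 : 4 * r < 4 * η + 3 * d + 4 := by
        have : 4 * (r : ℝ) < 4 * η + 3 * d + 4 := by linarith
        exact_mod_cast this
      refine ⟨by omega, by omega, fun D hD => ?_⟩
      have : 4 + 4 * D ≤ d := by omega
      omega

/-! ### Narrowest-over-threshold selection on the noise event -/

/-- The ratio 2304/24 = 96 would even allow d/96; d/16 is all that is needed later. -/
theorem close_of_jump_sq_mul_le {T d η s : ℕ} {f : ℕ → ℝ} {M : ℝ} (hη : η ∈ changePoints T f)
    (hdet : 2304 * M ^ 2 ≤ (f (η + 1) - f η) ^ 2 * d)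
    (hs : (f (η + 1) - f η) ^ 2 * |(s : ℝ) - η| ≤ 24 * M ^ 2) :
    s ≤ η + d / 16 ∧ η ≤ s + d / 16 := by
  have hpos : 0 < (f (η + 1) - f η) ^ 2 := by
    have := sub_ne_zero.2 (mem_changePoints.1 hη).2
    positivity
  have h : 16 * |(s : ℝ) - η| ≤ d := by
    refine le_of_mul_le_mul_left ?_ hpos
    nlinarith [sq_nonneg M]
  have h1 := le_abs_self ((s : ℝ) - η)
  have h2 := neg_abs_le ((s : ℝ) - η)
  have h3 : 16 * s ≤ 16 * η + d := by
    have : 16 * (s : ℝ) ≤ 16 * η + d := by linarith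
    exact_mod_cast this
  have h4 : 16 * η ≤ 16 * s + d := by
    have : 16 * (η : ℝ) ≤ 16 * s + d := by linarith
    exact_mod_cast this
  omega

theorem eq_left_of_isolated {T l η : ℕ} {f : ℕ → ℝ} (hη : η ∈ changePoints T f)
    (h : η ≤ l + minSpacing T f) (t : ℕ) (hlt : l < t) (ht : t ≤ η) : f t = f η := by
  have hηT := (mem_changePoints.1 hη).1
  refine (eq_of_no_changePoint (T := T) (by omega) ht (by omega) fun y hy hty => ?_).symm
  by_contra hlt'
  have := add_minSpacing_le hy hη (by omega)
  omega

theorem eq_right_of_isolated {T r η : ℕ} {f : ℕ → ℝ} (hη : η ∈ changePoints T f) (hr : r ≤ T)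
    (h : r ≤ η + minSpacing T f) (t : ℕ) (hlt : η < t) (ht : t ≤ r) : f t = f (η + 1) := by
  refine eq_of_no_changePoint (T := T) (by omega) hlt (by omega) fun y hy hty => ?_
  have := add_minSpacing_le hη hy (by omega)
  omega

theorem exists_isBestSplit {T : ℕ} (x : Obs T → ℝ) {l η r : ℕ} (h1 : l < η) (h2 : η < r) :
    ∃ s, IsBestSplit x (l, r) s ∧ |cusum x (l, r) η| ≤ |cusum x (l, r) s| := by
  have hη : η ∈ Finset.Ioo l r := Finset.mem_Ioo.2 ⟨h1, h2⟩
  obtain ⟨s, hs, hmax⟩ := Finset.exists_max_image (Finset.Ioo l r) (fun s => |cusum x (l, r) s|)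
    ⟨η, hη⟩
  exact ⟨s, ⟨hs, hmax⟩, hmax η hη⟩

/-- A balanced interval around an isolated change is over the threshold. -/
theorem overThreshold_of_balanced {T l r η : ℕ} {f : ℕ → ℝ} {M : ℝ} {x : Obs T → ℝ} (hM : 0 < M)
    (hx : NoiseBounded T f M x) (hη : η ∈ changePoints T f) (hl : l < η) (hηr : η < r) (hr : r ≤ T)
    (hl' : η ≤ l + minSpacing T f) (hr' : r ≤ η + minSpacing T f)
    (hbl : minSpacing T f ≤ 8 * (η - l)) (hbr : minSpacing T f ≤ 8 * (r - η))
    (hdet : 2304 * M ^ 2 ≤ (f (η + 1) - f η) ^ 2 * minSpacing T f) :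
    OverThreshold (10 * M) x (l, r) := by
  have h := le_abs_cusum hM.le hx hl hηr hr (eq_left_of_isolated hη hl')
    (eq_right_of_isolated hη hr hr')
  obtain ⟨s, hs, hle⟩ := exists_isBestSplit x hl hηr
  refine ⟨s, hs, lt_of_lt_of_le ?_ hle⟩
  refine lt_of_lt_of_le ?_ h
  have hA : (0 : ℝ) < η - l := by rw [sub_pos]; exact_mod_cast hl
  have hR : (0 : ℝ) < r - η := by rw [sub_pos]; exact_mod_cast hηr
  have hbl' : (minSpacing T f : ℝ) ≤ 8 * (η - l) := by
    rw [← Nat.cast_sub hl.le]; exact_mod_cast hbl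
  have hbr' : (minSpacing T f : ℝ) ≤ 8 * (r - η) := by
    rw [← Nat.cast_sub hηr.le]; exact_mod_cast hbr
  -- Both factors are at least λ/8, and a product over a sum is at least half the smaller factor.
  -- Then 2304/16 = 12², and 12M less the noise 3M/2 still exceeds 10M.
  have hw : (minSpacing T f : ℝ) / 16 ≤ ((η : ℝ) - l) * (r - η) / (r - l) := by
    rw [le_div_iff₀ (by linarith)]
    nlinarith
  have h12 : 12 * M ≤ √(((η : ℝ) - l) * (r - η) / (r - l)) * |f η - f (η + 1)| := by
    rw [← Real.sqrt_sq_eq_abs, ← Real.sqrt_mul (by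
      exact le_trans (by positivity) hw)]
    refine Real.le_sqrt_of_sq_le ?_
    have := mul_le_mul_of_nonneg_right hw (sq_nonneg (f η - f (η + 1)))
    nlinarith
  linarith

/-- If all changes inside an interval lie close to its boundary, the interval is not over the
threshold. -/
theorem abs_cusum_le_of_changes_near_boundary {T l r s : ℕ} {f : ℕ → ℝ} {M : ℝ} {x : Obs T → ℝ}
    (hM : 0 < M) (hx : NoiseBounded T f M x) (hr : r ≤ T) (hls : l < s) (hsr : s < r)
    (hdet : ∀ η ∈ changePoints T f,
      2304 * M ^ 2 ≤ (f (η + 1) - f η) ^ 2 * minSpacing T f)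
    (hnear : ∀ η ∈ changePoints T f, l < η → η < r →
      ∃ z : ℕ, (f (η + 1) - f η) ^ 2 * |(z : ℝ) - η| ≤ 24 * M ^ 2 ∧ (z ≤ l ∨ r < z)) :
    |cusum x (l, r) s| ≤ 10 * M := by
  set d := minSpacing T f with hd
  have hsplit : ∀ η ∈ changePoints T f, l < η → η < r →
      ((f (η + 1) - f η) ^ 2 * ((η : ℝ) - l) ≤ 24 * M ^ 2 ∧ η ≤ l + d / 16) ∨
      ((f (η + 1) - f η) ^ 2 * ((r : ℝ) - η) ≤ 24 * M ^ 2 ∧ r ≤ η + d / 16) := by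
    intro η hη h1 h2
    obtain ⟨z, hz, hzl | hzr⟩ := hnear η hη h1 h2
    · left
      have hc := close_of_jump_sq_mul_le hη (hdet η hη) hz
      refine ⟨le_trans (mul_le_mul_of_nonneg_left ?_ (sq_nonneg _)) hz, by omega⟩
      rw [abs_sub_comm]
      have : (z : ℝ) ≤ l := by exact_mod_cast hzl
      exact le_trans (by linarith) (le_abs_self _)
    · right
      have hc := close_of_jump_sq_mul_le hη (hdet η hη) hz
      refine ⟨le_trans (mul_le_mul_of_nonneg_left ?_ (sq_nonneg _)) hz, by omega⟩
      have : (r : ℝ) ≤ z := by exact_mod_cast hzr.le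
      exact le_trans (by linarith) (le_abs_self _)
  -- At most one change lies within λ/16 of the left end, by spacing. It is p; without such a change
  -- p = l, which contributes no energy. The point q plays the same role on the right.
  obtain ⟨p, hlp, hpr, hpE, hpd, hpu, hpcp⟩ : ∃ p : ℕ, l ≤ p ∧ p < r ∧
      (f (p + 1) - f p) ^ 2 * ((p : ℝ) - l) ≤ 24 * M ^ 2 ∧ p ≤ l + d / 16 ∧
      (∀ η ∈ changePoints T f, l < η → η < r →
        (f (η + 1) - f η) ^ 2 * ((η : ℝ) - l) ≤ 24 * M ^ 2 ∧ η ≤ l + d / 16 → η = p) ∧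
      (p = l ∨ p ∈ changePoints T f) := by
    by_cases hex : ∃ η ∈ changePoints T f, l < η ∧ η < r ∧
        (f (η + 1) - f η) ^ 2 * ((η : ℝ) - l) ≤ 24 * M ^ 2 ∧ η ≤ l + d / 16
    · obtain ⟨η, hη, h1, h2, h3, h4⟩ := hex
      refine ⟨η, h1.le, h2, h3, h4, fun y hy h5 h6 h7 => ?_, .inr hη⟩
      rcases lt_trichotomy y η with h | h | h
      · have := add_minSpacing_le hy hη h
        omega
      · exact h
      · have := add_minSpacing_le hη hy h
        omega
    · exact ⟨l, le_rfl, by omega, by simp; positivity, by omega,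
        fun y hy h5 h6 h7 => absurd ⟨y, hy, h5, h6, h7⟩ hex, .inl rfl⟩
  obtain ⟨q, hlq, hqr, hqE, hqd, hqu, hqcp⟩ : ∃ q : ℕ, l < q ∧ q ≤ r ∧
      (f (q + 1) - f q) ^ 2 * ((r : ℝ) - q) ≤ 24 * M ^ 2 ∧ r ≤ q + d / 16 ∧
      (∀ η ∈ changePoints T f, l < η → η < r →
        (f (η + 1) - f η) ^ 2 * ((r : ℝ) - η) ≤ 24 * M ^ 2 ∧ r ≤ η + d / 16 → η = q) ∧
      (q = r ∨ q ∈ changePoints T f) := by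
    by_cases hex : ∃ η ∈ changePoints T f, l < η ∧ η < r ∧
        (f (η + 1) - f η) ^ 2 * ((r : ℝ) - η) ≤ 24 * M ^ 2 ∧ r ≤ η + d / 16
    · obtain ⟨η, hη, h1, h2, h3, h4⟩ := hex
      refine ⟨η, h1, h2.le, h3, h4, fun y hy h5 h6 h7 => ?_, .inr hη⟩
      rcases lt_trichotomy y η with h | h | h
      · have := add_minSpacing_le hy hη h
        omega
      · exact h
      · have := add_minSpacing_le hη hy h
        omega
    · exact ⟨r, by omega, le_rfl, by simp; positivity, by omega,
        fun y hy h5 h6 h7 => absurd ⟨y, hy, h5, h6, h7⟩ hex, .inl rfl⟩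
  have hpq : p ≤ q := by
    rcases hpcp with rfl | hp
    · exact hlq.le
    rcases hqcp with rfl | hq
    · exact hpr.le
    by_contra hlt
    have := add_minSpacing_le hq hp (by omega)
    omega
  have hleft : ∀ t ∈ Finset.Ioc l p, f t = f p := by
    intro t ht
    rw [Finset.mem_Ioc] at ht
    rcases hpcp with rfl | hp
    · omega
    · exact eq_left_of_isolated hp (by omega) t ht.1 ht.2
  have hmid : ∀ t ∈ Finset.Ioc p q, f t = f (p + 1) := by
    intro t ht
    rw [Finset.mem_Ioc] at ht
    refine eq_of_no_changePoint (T := T) (by omega) (by omega) (by omega) fun y hy hpy => ?_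
    by_contra hlt
    rcases hsplit y hy (by omega) (by omega) with h | h
    · have := hpu y hy (by omega) (by omega) h
      omega
    · have := hqu y hy (by omega) (by omega) h
      omega
  have hright : ∀ t ∈ Finset.Ioc q r, f t = f (q + 1) := by
    intro t ht
    rw [Finset.mem_Ioc] at ht
    rcases hqcp with rfl | hq
    · omega
    · exact eq_right_of_isolated hq hr (by omega) t ht.1 ht.2
  have hsum : ∑ t ∈ Finset.Ioc l r, (f t - f (p + 1)) ^ 2 ≤ 48 * M ^ 2 := by
    rw [← Finset.sum_Ioc_consecutive _ hlp (hpq.trans hqr), ← Finset.sum_Ioc_consecutive _ hpq hqr]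
    have e1 : ∑ t ∈ Finset.Ioc l p, (f t - f (p + 1)) ^ 2 ≤ 24 * M ^ 2 := by
      rw [Finset.sum_congr rfl fun t ht => by rw [hleft t ht], Finset.sum_const, Nat.card_Ioc,
        nsmul_eq_mul, Nat.cast_sub hlp, mul_comm, ← neg_sub (f (p + 1)), neg_sq]
      exact hpE
    have e2 : ∑ t ∈ Finset.Ioc p q, (f t - f (p + 1)) ^ 2 = 0 :=
      Finset.sum_eq_zero fun t ht => by rw [hmid t ht]; ring
    have e3 : ∑ t ∈ Finset.Ioc q r, (f t - f (p + 1)) ^ 2 ≤ 24 * M ^ 2 := by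
      -- If p = q, one change is close to both ends and the signal on (q, r] is already f (p + 1).
      -- Otherwise f q = f (p + 1), and the deviation is the jump at q.
      rcases hpq.eq_or_lt with rfl | hlt
      · rw [Finset.sum_eq_zero fun t ht => by rw [hright t ht]; ring]
        positivity
      · rw [Finset.sum_congr rfl fun t ht => by
            rw [hright t ht, ← hmid q (Finset.mem_Ioc.2 ⟨hlt, le_rfl⟩)],
          Finset.sum_const, Nat.card_Ioc, nsmul_eq_mul, Nat.cast_sub hqr, mul_comm]
        exact hqE
    linarith
  -- Since 48 ≤ 7², signal and noise together give at most 7M + 3M/2, below the threshold 10M.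
  have h7 : √(∑ t ∈ Finset.Ioc l r, (f t - f (p + 1)) ^ 2) ≤ 7 * M := by
    refine Real.sqrt_le_iff.2 ⟨by positivity, hsum.trans ?_⟩
    nlinarith [sq_nonneg M]
  have := abs_cusum_le hM.le hx hls hsr hr (f (p + 1))
  linarith

/-- In an interval that is not longer than the minimal spacing plus one, a best split over the
threshold localises the change inside the interval. -/
theorem localised_of_narrow {T l r η s : ℕ} {f : ℕ → ℝ} {M : ℝ} {x : Obs T → ℝ} (hM : 0 < M)
    (hx : NoiseBounded T f M x) (hη : η ∈ changePoints T f) (hl : l < η) (hηr : η < r) (hr : r ≤ T)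
    (hlen : r ≤ l + minSpacing T f + 1) (hs : IsBestSplit x (l, r) s)
    (hbig : 10 * M < |cusum x (l, r) s|) :
    (f (η + 1) - f η) ^ 2 * |(s : ℝ) - η| ≤ 24 * M ^ 2 := by
  have := jump_sq_mul_dist_le hM.le hx hl hηr hr
    (eq_left_of_isolated hη (by omega)) (eq_right_of_isolated hη hr (by omega)) hs hbig
  rwa [← neg_sub (f (η + 1)), neg_sq] at this

/-- Every change is the centre of a short over-threshold seeded interval that avoids accurate
estimates of the other changes. -/
theorem exists_overThreshold_around {a : ℝ} {T m : ℕ} {f : ℕ → ℝ} {M : ℝ} {x : Obs T → ℝ}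
    (ha : 1 / 2 ≤ a) (ha1 : a < 1) (hM : 0 < M) (hx : NoiseBounded T f M x)
    (hd : 2 ≤ minSpacing T f) (hm : (m : ℝ) ≤ a * minSpacing T f + 1)
    (hdet : ∀ η ∈ changePoints T f, 2304 * M ^ 2 ≤ (f (η + 1) - f η) ^ 2 * minSpacing T f)
    {η : ℕ} (hη : η ∈ changePoints T f) :
    ∃ J ∈ seededIntervals a T, m ≤ J.2 - J.1 ∧ OverThreshold (10 * M) x J ∧
      J.2 - J.1 ≤ minSpacing T f + 1 ∧
      ∀ y ∈ changePoints T f, y ≠ η → ∀ z : ℕ,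
        (f (y + 1) - f y) ^ 2 * |(z : ℝ) - y| ≤ 24 * M ^ 2 → ¬ (J.1 < z ∧ z ≤ J.2) := by
  have hη' := minSpacing_spec hη
  obtain ⟨l, r, hmem, hlen, hup, hl, hr, hbl, hbr, hD⟩ :=
    exists_seeded_around ha ha1 hd hη'.1 hη'.2 hm
  have hrT : r ≤ T := right_le_of_mem_seededIntervals (by linarith) ha1 hmem
  have hD0 := hD 0 (by omega)
  refine ⟨(l, r), hmem, hlen, overThreshold_of_balanced hM hx hη hl hr hrT (by omega) (by omega)
    hbl hbr (hdet η hη), by simp only; omega, fun y hy hne z hz => ?_⟩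
  have hc := close_of_jump_sq_mul_le hy (hdet y hy) hz
  -- An accurate estimate of another change is at most λ/16 closer to η than that change; this
  -- margin keeps it at or left of l, or strictly right of r, as the half-open interval requires.
  have hD1 := hD (minSpacing T f / 16) (by omega)
  simp only
  rcases lt_or_gt_of_ne hne with h | h
  · have := add_minSpacing_le hy hη h
    omega
  · have := add_minSpacing_le hη hy h
    omega

/-- The induction is generalised over the state of a run: D is the set of changes already detected,
σ their estimates, and the active intervals are those over the threshold that contain none of these
estimates. -/
theorem narrowestRun_spec {a : ℝ} {T m : ℕ} {f : ℕ → ℝ} {M : ℝ} {x : Obs T → ℝ}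
    (ha : 1 / 2 ≤ a) (ha1 : a < 1) (hM : 0 < M) (hx : NoiseBounded T f M x)
    (hd : 2 ≤ minSpacing T f) (hm : (m : ℝ) ≤ a * minSpacing T f + 1)
    (hdet : ∀ η ∈ changePoints T f, 2304 * M ^ 2 ≤ (f (η + 1) - f η) ^ 2 * minSpacing T f)
    {A : Finset (ℕ × ℕ)} {S : Finset ℕ} (hrun : NarrowestRun x A S) :
    ∀ (D : Finset ℕ) (σ : ℕ → ℕ),
      (∀ η ∈ D, (f (η + 1) - f η) ^ 2 * |(σ η : ℝ) - η| ≤ 24 * M ^ 2) →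
      D ⊆ changePoints T f →
      (∀ J, J ∈ A ↔ (J ∈ seededIntervals a T ∧ m ≤ J.2 - J.1 ∧ OverThreshold (10 * M) x J) ∧
        ∀ η ∈ D, ¬ (J.1 < σ η ∧ σ η ≤ J.2)) →
      ∃ σ' : ℕ → ℕ, S = (changePoints T f \ D).image σ' ∧
        ∀ η ∈ changePoints T f \ D, (f (η + 1) - f η) ^ 2 * |(σ' η : ℝ) - η| ≤ 24 * M ^ 2 := by
  induction hrun with
  | done =>
    intro D σ hσ hDcp hA
    -- An undetected change would keep its own good interval active, but nothing is active any more.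
    have hempty : changePoints T f \ D = ∅ := by
      rw [Finset.eq_empty_iff_forall_notMem]
      intro η hη
      rw [Finset.mem_sdiff] at hη
      obtain ⟨J, h1, h2, h3, -, h5⟩ := exists_overThreshold_around ha ha1 hM hx hd hm hdet hη.1
      refine absurd ((hA J).2 ⟨⟨h1, h2, h3⟩, fun y hy => ?_⟩) (Finset.notMem_empty _)
      exact h5 y (hDcp hy) (fun h => hη.2 (h ▸ hy)) _ (hσ y hy)
    exact ⟨σ, by simp [hempty], by simp [hempty]⟩
  | step A I s S hI hmin hs hrun ih =>
    intro D σ hσ hDcp hA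
    obtain ⟨⟨hIseed, hIm, s₀, hs₀, hbig₀⟩, hIσ⟩ := (hA I).1 hI
    obtain ⟨l, r⟩ := I
    have hbig : 10 * M < |cusum x (l, r) s| := hbig₀.trans_le (hs.2 _ hs₀.1)
    have hrT : r ≤ T := right_le_of_mem_seededIntervals (by linarith) ha1 hIseed
    have hsI := Finset.mem_Ioo.1 hs.1
    simp only at hsI
    obtain ⟨η, hη, hlη, hηr, hηD⟩ : ∃ η ∈ changePoints T f, l < η ∧ η < r ∧ η ∉ D := by
      by_contra hcon
      refine absurd (abs_cusum_le_of_changes_near_boundary hM hx hrT hsI.1 hsI.2 hdet ?_)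
        (not_le.2 hbig)
      intro η hη h1 h2
      have hηD : η ∈ D := by
        by_contra h
        exact hcon ⟨η, hη, h1, h2, h⟩
      have := hIσ η hηD
      simp only at this
      exact ⟨σ η, hσ η hηD, by omega⟩
    obtain ⟨J, h1, h2, h3, h4, h5⟩ := exists_overThreshold_around ha ha1 hM hx hd hm hdet hη
    have hJA : J ∈ A := (hA J).2 ⟨⟨h1, h2, h3⟩, fun y hy =>
      h5 y (hDcp hy) (fun h => hηD (h ▸ hy)) _ (hσ y hy)⟩
    -- The good interval of η is still active, so the selected interval is no longer than λ + 1 and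
    -- can be localised.
    have hIJ := hmin J hJA
    simp only at hIJ
    have hacc := localised_of_narrow hM hx hη hlη hηr hrT (by omega) hs hbig
    obtain ⟨σ', hS, hσ'⟩ := ih (insert η D) (Function.update σ η s)
      (by
        intro y hy
        by_cases hyη : y = η
        · subst hyη; simpa using hacc
        · rw [Function.update_of_ne hyη]
          exact hσ y (Finset.mem_of_mem_insert_of_ne hy hyη))
      (Finset.insert_subset hη hDcp)
      (by
        intro K
        have hne : ∀ y ∈ D, Function.update σ η s y = σ y := fun y hy =>
          Function.update_of_ne (fun h : y = η => hηD (h ▸ hy)) _ _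
        rw [Finset.mem_filter, hA K, Finset.forall_mem_insert, Function.update_self, and_assoc,
          and_comm (a := ∀ y ∈ D, _)]
        refine and_congr_right fun _ => and_congr_right fun _ => ?_
        exact forall₂_congr fun y hy => by rw [hne y hy])
    have hins : changePoints T f \ D = insert η (changePoints T f \ insert η D) := by
      ext y
      simp only [Finset.mem_sdiff, Finset.mem_insert]
      by_cases hy : y = η
      · subst hy; simp [hη, hηD]
      · simp [hy]
    have hne : ∀ y ∈ changePoints T f \ insert η D, Function.update σ' η s y = σ' y := by
      intro y hy
      rw [Finset.mem_sdiff, Finset.mem_insert, not_or] at hy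
      exact Function.update_of_ne hy.2.1 _ _
    refine ⟨Function.update σ' η s, ?_, ?_⟩
    · rw [hins, Finset.image_insert, Function.update_self, hS, Finset.image_congr hne]
    · rw [hins, Finset.forall_mem_insert, Function.update_self]
      exact ⟨hacc, fun y hy => by rw [hne y hy]; exact hσ' y hy⟩

/-- On the noise event every output of the procedure is accurate. -/
theorem accurate_of_noiseBounded {a : ℝ} {T m : ℕ} {f : ℕ → ℝ} {M : ℝ} {x : Obs T → ℝ}
    (ha : 1 / 2 ≤ a) (ha1 : a < 1) (hM : 0 < M) (hx : NoiseBounded T f M x)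
    (hd : 2 ≤ minSpacing T f) (hm : (m : ℝ) ≤ a * minSpacing T f + 1)
    (hdet : ∀ η ∈ changePoints T f, 2304 * M ^ 2 ≤ (f (η + 1) - f η) ^ 2 * minSpacing T f)
    {S : Finset ℕ} (hS : IsOutput a m (10 * M) x S) : Accurate T f S (24 * M ^ 2) := by
  obtain ⟨σ, rfl, hσ⟩ := narrowestRun_spec ha ha1 hM hx hd hm hdet hS ∅ id (by simp) (by simp)
    (by intro J; simp)
  rw [Finset.sdiff_empty] at hσ ⊢
  refine accurate_image (fun y hy => ?_) hσ
  have hc := close_of_jump_sq_mul_le hy (hdet y hy) (hσ y hy)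
  have h1 : (σ y : ℝ) ≤ y + (minSpacing T f / 16 : ℕ) := by exact_mod_cast hc.1
  have h2 : (y : ℝ) ≤ σ y + (minSpacing T f / 16 : ℕ) := by exact_mod_cast hc.2
  have h3 : 2 * ((minSpacing T f / 16 : ℕ) : ℝ) < minSpacing T f := by
    have : 2 * (minSpacing T f / 16) < minSpacing T f := by omega
    exact_mod_cast this
  have := abs_le.2 (show -((minSpacing T f / 16 : ℕ) : ℝ) ≤ (σ y : ℝ) - y ∧
    (σ y : ℝ) - y ≤ (minSpacing T f / 16 : ℕ) from ⟨by linarith, by linarith⟩)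
  linarith

open MeasureTheory ProbabilityTheory

/-! ### The noise event -/

instance isProbabilityMeasure_law (T : ℕ) (f : ℕ → ℝ) : IsProbabilityMeasure (law T f) := by
  unfold law; infer_instance

theorem hasSubgaussianMGF_noise (T : ℕ) (f : ℕ → ℝ) (t : Obs T) :
    HasSubgaussianMGF (fun x : Obs T → ℝ => x t - f t.1) 1 (law T f) := by
  have hmp : MeasurePreserving (Function.eval t) (law T f) (gaussianReal (f t.1) 1) :=
    measurePreserving_eval (fun t : Obs T => gaussianReal (f t.1) 1) t
  have hm : (law T f).map (fun x : Obs T → ℝ => x t - f t.1) = gaussianReal 0 1 := by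
    have h1 : (fun x : Obs T → ℝ => x t - f t.1) = (fun y => y - f t.1) ∘ Function.eval t := rfl
    rw [h1, ← Measure.map_map (show Measurable fun y : ℝ => y - f t.1 from
      measurable_id.sub_const _) hmp.measurable, hmp.map_eq,
      gaussianReal_map_sub_const, sub_self]
  have hmgf : ∀ s, mgf (fun x : Obs T → ℝ => x t - f t.1) (law T f) s = Real.exp (s ^ 2 / 2) := by
    intro s
    rw [mgf_gaussianReal hm]; simp
  refine ⟨fun s => ?_, fun s => by rw [hmgf]; simp⟩
  have : 0 < mgf (fun x : Obs T → ℝ => x t - f t.1) (law T f) s := by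
    rw [hmgf]; exact Real.exp_pos _
  exact mgf_pos_iff.1 this

theorem iIndepFun_noise (T : ℕ) (f : ℕ → ℝ) :
    iIndepFun (fun (t : Obs T) (x : Obs T → ℝ) => x t - f t.1) (law T f) :=
  iIndepFun_pi (X := fun (t : Obs T) (y : ℝ) => y - f t.1)
    (fun _ => (measurable_id.sub_const _).aemeasurable)

theorem hasSubgaussianMGF_blockSum {T : ℕ} (f : ℕ → ℝ) {p q : ℕ} (hpq : p ≤ q) (hq : q ≤ T) :
    HasSubgaussianMGF (fun x : Obs T → ℝ => blockSum (fun t => x t - f t.1) p q) (q - p : ℕ)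
      (law T f) := by
  have h := HasSubgaussianMGF.sum_of_iIndepFun (iIndepFun_noise T f) (c := fun _ => 1)
    (s := Finset.univ.filter fun t : Obs T => p < t.1 ∧ t.1 ≤ q)
    (fun t _ => hasSubgaussianMGF_noise T f t)
  have hc := blockSum_const (T := T) (f := fun _ => 1) hpq hq (fun _ _ _ => rfl)
  rw [blockSum, Finset.sum_const, nsmul_eq_mul, mul_one, mul_one, ← Nat.cast_sub hpq,
    Nat.cast_inj] at hc
  rw [Finset.sum_const, nsmul_eq_mul, mul_one, hc] at h
  exact h

theorem law_abs_blockSum_ge_le {T : ℕ} (f : ℕ → ℝ) {p q : ℕ} (hpq : p < q) (hq : q ≤ T) {M : ℝ}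
    (hM : 0 ≤ M) :
    (law T f).real {x | M * √((q : ℝ) - p) ≤ |blockSum (fun t => x t - f t.1) p q|} ≤
      2 * Real.exp (-M ^ 2 / 2) := by
  have h := hasSubgaussianMGF_blockSum (T := T) f hpq.le hq
  have hpos : (0 : ℝ) < (q : ℝ) - p := by rw [sub_pos]; exact_mod_cast hpq
  have hε : 0 ≤ M * √((q : ℝ) - p) := by positivity
  have e : -(M * √((q : ℝ) - p)) ^ 2 / (2 * (((q - p : ℕ) : NNReal) : ℝ)) = -M ^ 2 / 2 := by
    rw [mul_pow, Real.sq_sqrt hpos.le, NNReal.coe_natCast, Nat.cast_sub hpq.le]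
    field_simp
  have h1 := h.measure_ge_le hε
  have h2 := h.neg.measure_ge_le hε
  rw [e] at h1 h2
  refine (measureReal_mono (s₂ := {x | M * √((q : ℝ) - p) ≤ blockSum (fun t => x t - f t.1) p q} ∪
    {x | M * √((q : ℝ) - p) ≤ (-fun x : Obs T → ℝ => blockSum (fun t => x t - f t.1) p q) x})
    ?_).trans ((measureReal_union_le _ _).trans (by linarith))
  intro x hx
  rw [Set.mem_ofPred_eq] at hx
  exact (le_abs.1 hx).imp id id

theorem law_not_noiseBounded_le (T : ℕ) (f : ℕ → ℝ) {M : ℝ} (hM : 0 ≤ M) :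
    (law T f).real {x | ¬ NoiseBounded T f M x} ≤ (T + 1) ^ 2 * (2 * Real.exp (-M ^ 2 / 2)) := by
  classical
  set P := ((Finset.range (T + 1)) ×ˢ (Finset.range (T + 1))).filter fun i => i.1 < i.2 with hP
  let B : ℕ × ℕ → Set (Obs T → ℝ) := fun i =>
    {x | M * √((i.2 : ℝ) - i.1) ≤ |blockSum (fun t => x t - f t.1) i.1 i.2|}
  have hsub : {x | ¬ NoiseBounded T f M x} ⊆ ⋃ i ∈ P, B i := by
    intro x hx
    simp only [NoiseBounded, Set.mem_ofPred_eq, not_forall, not_le] at hx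
    obtain ⟨p, q, hpq, hq, hlt⟩ := hx
    rw [Set.mem_iUnion₂]
    refine ⟨(p, q), ?_, hlt.le⟩
    rw [hP, Finset.mem_filter, Finset.mem_product, Finset.mem_range, Finset.mem_range]
    exact ⟨⟨by omega, by omega⟩, hpq⟩
  have hB : ∑ i ∈ P, (law T f).real (B i) ≤ (T + 1) ^ 2 * (2 * Real.exp (-M ^ 2 / 2)) := by
    refine (Finset.sum_le_card_nsmul P _ (2 * Real.exp (-M ^ 2 / 2)) fun i hi => ?_).trans ?_
    · rw [hP, Finset.mem_filter, Finset.mem_product, Finset.mem_range, Finset.mem_range] at hi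
      exact law_abs_blockSum_ge_le f hi.2 (by omega) hM
    · rw [nsmul_eq_mul]
      refine mul_le_mul_of_nonneg_right ?_ (by positivity)
      have : P.card ≤ (T + 1) ^ 2 := by
        refine (Finset.card_filter_le _ _).trans ?_
        simp [sq]
      exact_mod_cast this
  exact (measureReal_mono hsub (measure_ne_top _ _)).trans ((measureReal_biUnion_finset_le _ _).trans hB)

theorem law_not_noiseBounded_log_le {T : ℕ} (hT : 1 ≤ T) (f : ℕ → ℝ) :
    (law T f).real {x | ¬ NoiseBounded T f (3 * √(Real.log T)) x} ≤ 8 / T := by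
  have hT' : (1 : ℝ) ≤ T := by exact_mod_cast hT
  have hlog : 0 ≤ Real.log T := Real.log_nonneg hT'
  refine (law_not_noiseBounded_le T f (by positivity)).trans ?_
  -- The exponent 9/2 is weakened to the integer 3, which still beats the (T + 1)² ≤ 4T² blocks.
  have h1 : Real.exp (-(3 * √(Real.log T)) ^ 2 / 2) ≤ ((T : ℝ) ^ 3)⁻¹ := by
    rw [mul_pow, Real.sq_sqrt hlog]
    have : ((T : ℝ) ^ 3)⁻¹ = Real.exp (-(3 * Real.log T)) := by
      rw [Real.exp_neg]
      congr 1
      rw [show (3 : ℝ) * Real.log T = ((3 : ℕ) : ℝ) * Real.log T by norm_num, Real.exp_nat_mul,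
        Real.exp_log (by linarith)]
    rw [this]
    exact Real.exp_le_exp.2 (by linarith)
  have h2 : ((T : ℝ) + 1) ^ 2 ≤ 4 * (T : ℝ) ^ 2 := by nlinarith
  calc ((T : ℝ) + 1) ^ 2 * (2 * Real.exp (-(3 * √(Real.log T)) ^ 2 / 2))
      ≤ 4 * (T : ℝ) ^ 2 * (2 * ((T : ℝ) ^ 3)⁻¹) := by gcongr
    _ = 8 / (T : ℝ) := by field_simp; ring

/-- Subadditivity alone is used, so the events need not be measurable; this matters for a quantifier
over all outputs. -/
theorem tendsto_law_of_noiseBounded {f : ℕ → ℕ → ℝ} {E : ∀ T, Set (Obs T → ℝ)}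
    (h : ∀ᶠ T in atTop, ∀ x, NoiseBounded T (f T) (3 * √(Real.log T)) x → x ∈ E T) :
    Tendsto (fun T => law T (f T) (E T)) atTop (nhds 1) := by
  have hlim : Tendsto (fun T : ℕ => ENNReal.ofReal (1 - 8 / (T : ℝ))) atTop (nhds 1) := by
    have h1 : Tendsto (fun T : ℕ => 1 - 8 / (T : ℝ)) atTop (nhds (1 - 0)) :=
      tendsto_const_nhds.sub (tendsto_const_div_atTop_nhds_zero_nat 8)
    have h2 := ENNReal.tendsto_ofReal h1
    simpa using h2
  refine tendsto_of_tendsto_of_tendsto_of_le_of_le' hlim tendsto_const_nhds ?_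
    (Eventually.of_forall fun T => prob_le_one)
  filter_upwards [h, eventually_ge_atTop 1] with T hT hT1
  have hbad := law_not_noiseBounded_log_le hT1 (f T)
  have hunion : 1 ≤ (law T (f T)).real (E T) +
      (law T (f T)).real {x | ¬ NoiseBounded T (f T) (3 * √(Real.log T)) x} := by
    rw [← probReal_univ (μ := law T (f T))]
    refine (measureReal_mono ?_).trans (measureReal_union_le _ _)
    intro x _
    by_cases hx : NoiseBounded T (f T) (3 * √(Real.log T)) x
    · exact .inl (hT x hx)
    · exact .inr hx
  rw [ENNReal.ofReal_le_iff_le_toReal (measure_ne_top _ _)]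
  change _ ≤ (law T (f T)).real (E T)
  linarith

/-- Consistency and localisation rate of seeded binary segmentation. -/
theorem tendsto_law_accurate {a : ℝ} (ha : 1 / 2 ≤ a) (ha1 : a < 1) {m : ℕ → ℕ}
    (hm2 : ∀ T, 2 ≤ m T) {f : ℕ → ℕ → ℝ}
    (hm : ∀ᶠ T in atTop, (m T : ℝ) ≤ a * (minSpacing T (f T) : ℝ) + 1)
    (hdet : ∀ᶠ T in atTop, Detectable 20736 T (f T)) :
    Tendsto (fun T : ℕ => law T (f T)
      {x | ∀ S, IsOutput a (m T) (30 * √(Real.log T)) x S →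
        Accurate T (f T) S (216 * Real.log T)}) atTop (nhds 1) := by
  refine tendsto_law_of_noiseBounded ?_
  filter_upwards [hm, hdet, eventually_ge_atTop 2] with T hmT hdT hT x hx S hS
  have hlog : 0 < Real.log T := Real.log_pos (by exact_mod_cast hT)
  have hsq : (3 * √(Real.log T)) ^ 2 = 9 * Real.log T := by
    rw [mul_pow, Real.sq_sqrt hlog.le]; norm_num
  -- For λ ≤ 1 the bound m ≤ aλ + 1 would give m < 2, as a < 1.
  have hd : 2 ≤ minSpacing T (f T) := by
    have h1 : (2 : ℝ) ≤ m T := by exact_mod_cast hm2 T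
    by_contra hlt
    have h2 : (minSpacing T (f T) : ℝ) ≤ 1 := by exact_mod_cast (by omega)
    have h3 : (0 : ℝ) ≤ minSpacing T (f T) := Nat.cast_nonneg _
    nlinarith
  have := accurate_of_noiseBounded ha ha1 (M := 3 * √(Real.log T)) (by positivity) hx hd hmT
    (fun η hη => by
      rw [hsq]
      have := hdT.le_jump_sq hη
      linarith) (S := S) (by convert hS using 1; ring)
  rw [hsq] at this
  convert this using 1; ring

/-! ### Change of measure and lower bounds by mixtures -/

theorem lintegral_prod_eval {ι : Type*} [Fintype ι] (μ : ι → Measure ℝ)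
    [∀ i, IsProbabilityMeasure (μ i)] (h : ι → ℝ → ENNReal) (hh : ∀ i, Measurable (h i)) :
    ∫⁻ x, ∏ i, h i (x i) ∂Measure.pi μ = ∏ i, ∫⁻ y, h i y ∂μ i := by
  rw [lintegral_prod_eq_prod_lintegral_of_indepFun Finset.univ (fun i (x : ι → ℝ) => h i (x i))
    (iIndepFun_pi fun i => (hh i).aemeasurable) fun i => (hh i).comp (measurable_pi_apply i)]
  exact Finset.prod_congr rfl fun i _ => (measurePreserving_eval μ i).lintegral_comp (hh i)

theorem pi_withDensity {ι : Type*} [Fintype ι] (μ ν : ι → Measure ℝ)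
    [∀ i, IsProbabilityMeasure (μ i)] [∀ i, IsProbabilityMeasure (ν i)]
    (h : ι → ℝ → ENNReal) (hh : ∀ i, Measurable (h i)) (hν : ∀ i, ν i = (μ i).withDensity (h i)) :
    Measure.pi ν = (Measure.pi μ).withDensity fun x => ∏ i, h i (x i) := by
  refine Measure.pi_eq fun s hs => ?_
  rw [withDensity_apply _ (MeasurableSet.univ_pi hs),
    ← lintegral_indicator (MeasurableSet.univ_pi hs)]
  have h1 : (Set.univ.pi s).indicator (fun x : ι → ℝ => ∏ i, h i (x i)) =
      fun x => ∏ i, (s i).indicator (h i) (x i) := by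
    funext x
    by_cases hx : x ∈ Set.univ.pi s
    · rw [Set.indicator_of_mem hx]
      exact Finset.prod_congr rfl fun i _ => (Set.indicator_of_mem (hx i trivial) _).symm
    · rw [Set.indicator_of_notMem hx]
      simp only [Set.mem_univ_pi, not_forall] at hx
      obtain ⟨i, hi⟩ := hx
      exact (Finset.prod_eq_zero (Finset.mem_univ i) (Set.indicator_of_notMem hi _)).symm
  rw [h1, lintegral_prod_eval μ _ fun i => (hh i).indicator (hs i)]
  refine Finset.prod_congr rfl fun i _ => ?_
  rw [lintegral_indicator (hs i), hν i, withDensity_apply _ (hs i)]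

theorem gaussianReal_eq_withDensity (m m' : ℝ) :
    gaussianReal m' 1 = (gaussianReal m 1).withDensity fun y =>
      ENNReal.ofReal (Real.exp ((m' - m) * (y - m) - (m' - m) ^ 2 / 2)) := by
  rw [gaussianReal_of_var_ne_zero _ one_ne_zero, gaussianReal_of_var_ne_zero _ one_ne_zero,
    ← withDensity_mul _ (measurable_gaussianPDF _ _) (by fun_prop)]
  congr 1
  funext y
  rw [Pi.mul_apply, gaussianPDF, gaussianPDF, ← ENNReal.ofReal_mul (gaussianPDFReal_nonneg _ _ _)]
  congr 1
  rw [gaussianPDFReal, gaussianPDFReal, mul_assoc (√_)⁻¹, ← Real.exp_add]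
  congr 2
  simp only [NNReal.coe_one]
  ring

/-- The likelihood ratio of `law T g` with respect to `law T f`. -/
noncomputable def likelihood (T : ℕ) (f g : ℕ → ℝ) (x : Obs T → ℝ) : ℝ :=
  Real.exp (∑ t : Obs T, ((g t.1 - f t.1) * (x t - f t.1) - (g t.1 - f t.1) ^ 2 / 2))

theorem likelihood_nonneg (T : ℕ) (f g : ℕ → ℝ) (x : Obs T → ℝ) : 0 ≤ likelihood T f g x :=
  (Real.exp_pos _).le

theorem measurable_likelihood (T : ℕ) (f g : ℕ → ℝ) : Measurable (likelihood T f g) := by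
  unfold likelihood
  fun_prop

theorem law_eq_withDensity (T : ℕ) (f g : ℕ → ℝ) :
    law T g = (law T f).withDensity fun x => ENNReal.ofReal (likelihood T f g x) := by
  rw [law, pi_withDensity (fun t : Obs T => gaussianReal (f t.1) 1) _ _ (fun t => by fun_prop)
    fun t => gaussianReal_eq_withDensity (f t.1) (g t.1)]
  congr 1
  funext x
  rw [← ENNReal.ofReal_prod_of_nonneg fun _ _ => (Real.exp_pos _).le, likelihood, Real.exp_sum]

theorem integrable_likelihood (T : ℕ) (f g : ℕ → ℝ) :
    Integrable (likelihood T f g) (law T f) := by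
  refine ⟨(measurable_likelihood T f g).aestronglyMeasurable, ?_⟩
  rw [hasFiniteIntegral_iff_ofReal (ae_of_all _ (likelihood_nonneg T f g))]
  have h : law T g Set.univ = 1 := measure_univ
  rw [law_eq_withDensity T f g, withDensity_apply _ MeasurableSet.univ, setLIntegral_univ] at h
  rw [h]; exact ENNReal.one_lt_top

theorem law_real_eq_setIntegral (T : ℕ) (f g : ℕ → ℝ) {B : Set (Obs T → ℝ)}
    (hB : MeasurableSet B) : (law T g).real B = ∫ x in B, likelihood T f g x ∂law T f := by
  rw [integral_eq_lintegral_of_nonneg_ae (ae_of_all _ (likelihood_nonneg T f g))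
    (measurable_likelihood T f g).aestronglyMeasurable, measureReal_def]
  rw [← withDensity_apply _ hB, ← law_eq_withDensity T f g]

theorem integral_likelihood (T : ℕ) (f g : ℕ → ℝ) :
    ∫ x, likelihood T f g x ∂law T f = 1 := by
  rw [← setIntegral_univ, ← law_real_eq_setIntegral T f g MeasurableSet.univ, probReal_univ]

/-- A product of two exponential tilts is a constant times a third tilt, which has mean one; second
moments thus need no further Gaussian integral. -/
theorem likelihood_mul (T : ℕ) (f g h : ℕ → ℝ) (x : Obs T → ℝ) :
    likelihood T f g x * likelihood T f h x =
      Real.exp (∑ t : Obs T, (g t.1 - f t.1) * (h t.1 - f t.1)) *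
        likelihood T f (fun t => g t + h t - f t) x := by
  rw [likelihood, likelihood, likelihood, ← Real.exp_add, ← Real.exp_add,
    ← Finset.sum_add_distrib, ← Finset.sum_add_distrib]
  congr 1
  exact Finset.sum_congr rfl fun t _ => by ring

theorem integrable_likelihood_mul (T : ℕ) (f g h : ℕ → ℝ) :
    Integrable (fun x => likelihood T f g x * likelihood T f h x) (law T f) := by
  simp only [likelihood_mul]
  exact (integrable_likelihood _ _ _).const_mul _

theorem integral_likelihood_mul (T : ℕ) (f g h : ℕ → ℝ) :
    ∫ x, likelihood T f g x * likelihood T f h x ∂law T f =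
      Real.exp (∑ t : Obs T, (g t.1 - f t.1) * (h t.1 - f t.1)) := by
  simp only [likelihood_mul]
  rw [integral_const_mul, integral_likelihood, mul_one]

theorem integrable_likelihood_sub_one_mul (T : ℕ) (f g h : ℕ → ℝ) :
    Integrable (fun x => (likelihood T f g x - 1) * (likelihood T f h x - 1)) (law T f) := by
  have : (fun x => (likelihood T f g x - 1) * (likelihood T f h x - 1)) = fun x =>
      likelihood T f g x * likelihood T f h x - likelihood T f g x - likelihood T f h x + 1 := by
    funext x; ring
  rw [this]
  exact (((integrable_likelihood_mul T f g h).sub (integrable_likelihood T f g)).sub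
    (integrable_likelihood T f h)).add (integrable_const 1)

theorem integral_likelihood_sub_one_mul (T : ℕ) (f g h : ℕ → ℝ) :
    ∫ x, (likelihood T f g x - 1) * (likelihood T f h x - 1) ∂law T f =
      Real.exp (∑ t : Obs T, (g t.1 - f t.1) * (h t.1 - f t.1)) - 1 := by
  have : (fun x => (likelihood T f g x - 1) * (likelihood T f h x - 1)) = fun x =>
      likelihood T f g x * likelihood T f h x - likelihood T f g x - likelihood T f h x + 1 := by
    funext x; ring
  have i1 := integrable_likelihood_mul T f g h
  have i2 := integrable_likelihood T f g
  have i3 := integrable_likelihood T f h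
  have i4 : Integrable (fun x => likelihood T f g x * likelihood T f h x - likelihood T f g x)
    (law T f) := i1.sub i2
  have i5 : Integrable (fun x => likelihood T f g x * likelihood T f h x - likelihood T f g x -
    likelihood T f h x) (law T f) := i4.sub i3
  rw [this, integral_add i5 (integrable_const 1), integral_sub i4 i3,
    integral_sub i1 i2, integral_likelihood_mul, integral_likelihood, integral_likelihood]
  simp

/-- If many signals differ from `f` on disjoint sets by a bounded amount, then one of them is hard
to distinguish from `f` on the event `B`. -/
theorem exists_law_le_add_half {T n : ℕ} (hn : 0 < n) (f : ℕ → ℝ) (g : Fin n → ℕ → ℝ) {v : ℝ}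
    (hdisj : ∀ i j, i ≠ j → ∀ t, (g i t - f t) * (g j t - f t) = 0)
    (hv : ∀ i, ∑ t : Obs T, (g i t.1 - f t.1) ^ 2 ≤ v) (hvn : Real.exp v ≤ n / 4)
    {B : Set (Obs T → ℝ)} (hB : MeasurableSet B) :
    ∃ i, (law T (g i)).real B ≤ (law T f).real B + 1 / 2 := by
  by_contra hcon
  simp only [not_exists, not_le] at hcon
  have hn' : (0 : ℝ) < n := by exact_mod_cast hn
  set W : (Obs T → ℝ) → ℝ := fun x => ∑ i, (likelihood T f (g i) x - 1) with hW
  have hint1 : ∀ i, Integrable (fun x => likelihood T f (g i) x - 1) (law T f) := fun i =>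
    (integrable_likelihood T f (g i)).sub (integrable_const 1)
  have hWint : Integrable W (law T f) := integrable_finsetSum _ fun i _ => hint1 i
  have hWsq : (fun x => W x ^ 2) = fun x =>
      ∑ i, ∑ j, (likelihood T f (g i) x - 1) * (likelihood T f (g j) x - 1) := by
    funext x
    rw [hW, sq, Finset.sum_mul_sum]
  have hWsqint : Integrable (fun x => W x ^ 2) (law T f) := by
    rw [hWsq]
    exact integrable_finsetSum _ fun i _ => integrable_finsetSum _ fun j _ =>
      integrable_likelihood_sub_one_mul _ _ _ _
  have hWsqval : ∫ x, W x ^ 2 ∂law T f ≤ n * Real.exp v := by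
    rw [hWsq, integral_finsetSum _ fun i _ => integrable_finsetSum _ fun j _ =>
      integrable_likelihood_sub_one_mul _ _ _ _]
    have h1 : ∀ i : Fin n, ∫ x, ∑ j, (likelihood T f (g i) x - 1) *
        (likelihood T f (g j) x - 1) ∂law T f ≤ Real.exp v := by
      intro i
      rw [integral_finsetSum _ fun j _ => integrable_likelihood_sub_one_mul _ _ _ _]
      simp only [integral_likelihood_sub_one_mul]
      rw [Finset.sum_eq_single i]
      · have h2 : ∑ t : Obs T, (g i t.1 - f t.1) * (g i t.1 - f t.1) ≤ v := by
          simpa only [sq] using hv i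
        have := Real.exp_le_exp.2 h2
        linarith
      -- Disjoint supports make the exponent zero, so distinct centred likelihood ratios are
      -- orthogonal.
      · intro j _ hji
        rw [Finset.sum_eq_zero fun t _ => hdisj i j hji.symm t.1, Real.exp_zero, sub_self]
      · simp
    refine (Finset.sum_le_sum fun i _ => h1 i).trans ?_
    simp
  have hsum : ∑ i, ((law T (g i)).real B - (law T f).real B) = ∫ x in B, W x ∂law T f := by
    rw [hW, integral_finsetSum _ fun i _ => (hint1 i).integrableOn]
    refine Finset.sum_congr rfl fun i _ => ?_
    rw [integral_sub (integrable_likelihood T f (g i)).integrableOn (integrable_const 1),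
      ← law_real_eq_setIntegral T f (g i) hB]
    simp
  have hlow : (n : ℝ) / 2 < ∑ i, ((law T (g i)).real B - (law T f).real B) := by
    have : ∑ _i : Fin n, (1 / 2 : ℝ) < ∑ i, ((law T (g i)).real B - (law T f).real B) :=
      Finset.sum_lt_sum_of_nonempty ⟨⟨0, hn⟩, Finset.mem_univ _⟩
        fun i _ => by have := hcon i; linarith
    simp only [Finset.sum_const, Finset.card_univ, Fintype.card_fin, nsmul_eq_mul] at this
    linarith
  have hup : ∫ x in B, W x ∂law T f ≤ n / 2 := by
    have hmaj : Integrable (fun x => W x ^ 2 / n + n / 4) (law T f) :=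
      (hWsqint.div_const _).add (integrable_const _)
    calc ∫ x in B, W x ∂law T f ≤ ∫ x in B, (W x ^ 2 / n + n / 4) ∂law T f := by
          refine setIntegral_mono hWint.integrableOn hmaj.integrableOn fun x => ?_
          -- This quadratic majorant of W replaces Cauchy–Schwarz and is nonnegative, so the
          -- integral over B can be extended to the whole space.
          have h1 : W x ^ 2 / n + n / 4 - W x = (W x - n / 2) ^ 2 / n := by
            field_simp; ring
          have h2 : 0 ≤ (W x - n / 2) ^ 2 / n := by positivity
          simp only
          linarith
      _ ≤ ∫ x, (W x ^ 2 / n + n / 4) ∂law T f :=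
          setIntegral_le_integral hmaj (ae_of_all _ fun x => by
            simp only [Pi.zero_apply]; positivity)
      _ = (∫ x, W x ^ 2 ∂law T f) / n + n / 4 := by
          rw [integral_add (hWsqint.div_const _) (integrable_const _), integral_div]
          simp
      _ ≤ n / 2 := by
          have : (∫ x, W x ^ 2 ∂law T f) / n ≤ Real.exp v := by
            rw [div_le_iff₀ hn']; linarith
          linarith
  linarith

/-- No event can be likely under `f` while disjoint events are likely under all perturbations. -/
theorem law_le_or_exists_law_le {T n : ℕ} (hn : 0 < n) (f : ℕ → ℝ) (g : Fin n → ℕ → ℝ) {v : ℝ}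
    (hdisj : ∀ i j, i ≠ j → ∀ t, (g i t - f t) * (g j t - f t) = 0)
    (hv : ∀ i, ∑ t : Obs T, (g i t.1 - f t.1) ^ 2 ≤ v) (hvn : Real.exp v ≤ n / 4)
    {B : Set (Obs T → ℝ)} (hB : MeasurableSet B) {E : Fin n → Set (Obs T → ℝ)}
    (hE : ∀ i, Disjoint (E i) B) :
    law T f B ≤ ENNReal.ofReal (3 / 4) ∨ ∃ i, law T (g i) (E i) ≤ ENNReal.ofReal (3 / 4) := by
  by_cases h : law T f B ≤ ENNReal.ofReal (3 / 4)
  · exact .inl h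
  · right
    rw [ENNReal.le_ofReal_iff_toReal_le (measure_ne_top _ _) (by norm_num), not_le] at h
    change _ < (law T f).real B at h
    obtain ⟨i, hi⟩ := exists_law_le_add_half hn f g hdisj hv hvn hB.compl
    rw [probReal_compl_eq_one_sub (μ := law T f) hB] at hi
    -- Only the inclusion of E i in the complement of B is used, so E i may be non-measurable; 1/4 +
    -- 1/2 gives 3/4.
    refine ⟨i, (measure_mono (Set.subset_compl_iff_disjoint_right.2 (hE i))).trans ?_⟩
    rw [ENNReal.le_ofReal_iff_toReal_le (measure_ne_top _ _) (by norm_num)]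
    change (law T (g i)).real Bᶜ ≤ _
    linarith

theorem sum_obs_eq (T : ℕ) (F : ℕ → ℝ) : ∑ t : Obs T, F t.1 = ∑ t ∈ Finset.Icc 1 T, F t :=
  Finset.sum_coe_sort (Finset.Icc 1 T) F

theorem exp_half_log {x : ℝ} (hx : 0 < x) : Real.exp (1 / 2 * Real.log x) = √x := by
  rw [Real.sqrt_eq_rpow, Real.rpow_def_of_pos hx, mul_comm]

/-! ### Short bumps are not detectable -/

/-- A bump of height `δ` on the two time points `2 j + 3`, `2 j + 4`. -/
noncomputable def bump (δ : ℝ) (j t : ℕ) : ℝ := if t = 2 * j + 3 ∨ t = 2 * j + 4 then δ else 0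

theorem mem_changePoints_bump {T j x : ℕ} {δ : ℝ} (hδ : 0 < δ) (hj : 2 * j + 4 < T) :
    x ∈ changePoints T (bump δ j) ↔ x = 2 * j + 2 ∨ x = 2 * j + 4 := by
  rw [mem_changePoints]
  constructor
  · rintro ⟨-, h⟩
    by_contra hcon
    refine h ?_
    simp only [bump]
    congr 1
    rw [eq_iff_iff]
    omega
  · rintro (rfl | rfl)
    · refine ⟨by omega, ?_⟩
      simp [bump, hδ.ne']
    · refine ⟨by omega, ?_⟩
      simp [bump, hδ.ne]

theorem abs_jump_bump {j x : ℕ} {δ : ℝ} (hδ : 0 < δ) (hx : x = 2 * j + 2 ∨ x = 2 * j + 4) :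
    |bump δ j (x + 1) - bump δ j x| = δ := by
  rcases hx with rfl | rfl <;> simp [bump, abs_of_pos hδ]

theorem sum_sq_bump_le (T j : ℕ) (δ : ℝ) : ∑ t : Obs T, bump δ j t.1 ^ 2 ≤ 2 * δ ^ 2 := by
  classical
  rw [sum_obs_eq T fun t => bump δ j t ^ 2]
  have h1 : ∀ t, bump δ j t ^ 2 = if t ∈ ({2 * j + 3, 2 * j + 4} : Finset ℕ) then δ ^ 2 else 0 := by
    intro t
    simp only [bump, Finset.mem_insert, Finset.mem_singleton]
    split_ifs <;> simp
  simp only [h1]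
  rw [← Finset.sum_filter, Finset.sum_const, nsmul_eq_mul]
  refine mul_le_mul_of_nonneg_right ?_ (sq_nonneg δ)
  have : (Finset.filter (· ∈ ({2 * j + 3, 2 * j + 4} : Finset ℕ)) (Finset.Icc 1 T)).card ≤ 2 := by
    refine (Finset.card_le_card (t := {2 * j + 3, 2 * j + 4}) fun t ht => ?_).trans
      Finset.card_le_two
    exact (Finset.mem_filter.1 ht).2
  exact_mod_cast this

theorem changePoints_zero (T : ℕ) : changePoints T (fun _ => (0 : ℝ)) = ∅ := by
  simp [changePoints]

theorem detection_lower_bound {T : ℕ} (hT : 256 ≤ T) (Nhat : (Obs T → ℝ) → ℕ)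
    (hN : Measurable Nhat) :
    ∃ f : ℕ → ℝ, 2 ≤ minSpacing T f ∧ Detectable (1 / 2) T f ∧
      law T f {x | Nhat x = numChanges T f} ≤ ENNReal.ofReal (3 / 4) := by
  have hT' : (256 : ℝ) ≤ T := by exact_mod_cast hT
  have hlog : 0 < Real.log T := Real.log_pos (by linarith)
  -- A bump has energy 2δ² = (log T)/2, so e^v = √T against about T/2 disjoint alternatives; the
  -- same 2δ² meets the detection condition with constant 1/2.
  set δ := √(1 / 4 * Real.log T) with hδ
  have hδ0 : 0 < δ := Real.sqrt_pos.2 (by positivity)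
  have hδsq : δ ^ 2 = 1 / 4 * Real.log T := Real.sq_sqrt (by positivity)
  have hN0 : numChanges T (fun _ => (0 : ℝ)) = 0 := by rw [numChanges, changePoints_zero]; rfl
  have hNj : ∀ j : Fin (T / 2 - 2), numChanges T (bump δ j) ≠ 0 := by
    intro j
    have hj := j.2
    exact (Finset.card_pos.2 ⟨2 * (j : ℕ) + 2,
      (mem_changePoints_bump hδ0 (by omega)).2 (.inl rfl)⟩).ne'
  refine (law_le_or_exists_law_le (T := T) (n := T / 2 - 2) (by omega) (fun _ => 0)
    (fun j => bump δ j) (v := 1 / 2 * Real.log T) ?_ ?_ ?_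
    (B := {x | Nhat x = numChanges T (fun _ => (0 : ℝ))})
    (hN (measurableSet_singleton (numChanges T (fun _ => (0 : ℝ)))))
    (E := fun j => {x | Nhat x = numChanges T (bump δ j)}) ?_).elim ?_ ?_
  · intro i j hij t
    have hij' : (i : ℕ) ≠ j := fun h => hij (Fin.ext h)
    simp only [bump, sub_zero]
    split_ifs with h1 h2
    · omega
    all_goals simp
  · intro j
    simp only [sub_zero]
    refine (sum_sq_bump_le T j δ).trans ?_
    rw [hδsq]
    linarith
  · rw [exp_half_log (by linarith)]
    have h1 : √(T : ℝ) ≤ T / 16 := by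
      rw [Real.sqrt_le_iff]
      refine ⟨by positivity, ?_⟩
      nlinarith
    have h2 : (T : ℝ) ≤ 4 * (T / 2 - 2 : ℕ) := by
      have : T ≤ 4 * (T / 2 - 2) := by omega
      exact_mod_cast this
    linarith
  · intro j
    rw [Set.disjoint_left]
    intro x hx hx0
    rw [Set.mem_ofPred_eq] at hx hx0
    rw [hN0] at hx0
    exact hNj j (hx.symm.trans hx0)
  · intro h
    refine ⟨fun _ => 0, le_minSpacing (by omega) ?_ ?_, ?_, h⟩
    · simp [changePoints_zero]
    · simp [changePoints_zero]
    · intro h0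
      rw [hN0] at h0
      exact absurd h0 (lt_irrefl _)
  · rintro ⟨j, hj⟩
    have hjT : 2 * (j : ℕ) + 6 ≤ T := by
      have := j.2
      omega
    have hsp : 2 ≤ minSpacing T (bump δ j) := by
      refine le_minSpacing (by omega) (fun x hx => ?_) (fun x hx y hy hxy => ?_)
      · rw [mem_changePoints_bump hδ0 (by omega)] at hx
        omega
      · rw [mem_changePoints_bump hδ0 (by omega)] at hx hy
        omega
    refine ⟨bump δ j, hsp, detectable_of_forall_jump hδ0.le (fun x hx => ?_) hsp ?_, hj⟩
    · rw [mem_changePoints_bump hδ0 (by omega)] at hx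
      exact (abs_jump_bump hδ0 hx).ge
    · rw [hδsq]
      push_cast
      linarith

/-! ### Staircases cannot be localised faster -/

/-- The staircase with `n` steps of height `δ` at the locations `g 0 < g 1 < …`. -/
noncomputable def stair (δ : ℝ) (n : ℕ) (g : ℕ → ℕ) (t : ℕ) : ℝ :=
  ∑ i ∈ Finset.range n, if g i < t then δ else 0

theorem stair_succ_sub (δ : ℝ) (n : ℕ) (g : ℕ → ℕ) (t : ℕ) :
    stair δ n g (t + 1) - stair δ n g t = ∑ i ∈ Finset.range n, if g i = t then δ else 0 := by
  rw [stair, stair, ← Finset.sum_sub_distrib]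
  refine Finset.sum_congr rfl fun i _ => ?_
  rcases lt_trichotomy (g i) t with h | h | h
  · simp [h, h.ne, h.trans (Nat.lt_succ_self t)]
  · simp [h]
  · rw [if_neg (by omega), if_neg (by omega), if_neg (by omega), sub_zero]

theorem stair_jump {δ : ℝ} {n i : ℕ} {g : ℕ → ℕ} (hg : StrictMono g) (hi : i < n) :
    stair δ n g (g i + 1) - stair δ n g (g i) = δ := by
  rw [stair_succ_sub, Finset.sum_eq_single i]
  · simp
  · intro j _ hj
    rw [if_neg (fun h => hj (hg.injective h))]
  · intro h
    exact absurd (Finset.mem_range.2 hi) h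

theorem changePoints_stair {T n : ℕ} {δ : ℝ} {g : ℕ → ℕ} (hδ : 0 < δ) (hg : StrictMono g)
    (hgT : ∀ i < n, 1 ≤ g i ∧ g i < T) :
    changePoints T (stair δ n g) = (Finset.range n).image g := by
  ext x
  rw [mem_changePoints, Finset.mem_image]
  constructor
  · rintro ⟨-, h⟩
    by_contra hcon
    refine h (sub_eq_zero.1 ?_)
    rw [stair_succ_sub]
    exact Finset.sum_eq_zero fun i hi => if_neg fun h' => hcon ⟨i, hi, h'⟩
  · rintro ⟨i, hi, rfl⟩
    rw [Finset.mem_range] at hi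
    exact ⟨hgT i hi, fun h => hδ.ne' (by rw [← stair_jump (δ := δ) hg hi, h, sub_self])⟩

theorem numChanges_stair {T n : ℕ} {δ : ℝ} {g : ℕ → ℕ} (hδ : 0 < δ) (hg : StrictMono g)
    (hgT : ∀ i < n, 1 ≤ g i ∧ g i < T) : numChanges T (stair δ n g) = n := by
  rw [numChanges, changePoints_stair hδ hg hgT, Finset.card_image_of_injective _ hg.injective,
    Finset.card_range]

theorem eta_stair {T n i : ℕ} {δ : ℝ} {g : ℕ → ℕ} (hδ : 0 < δ) (hg : StrictMono g)
    (hgT : ∀ i < n, 1 ≤ g i ∧ g i < T) (hi : i < n) : eta T (stair δ n g) (i + 1) = g i := by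
  rw [eta, changePoints_stair hδ hg hgT]
  refine loc_eq_of_strictMono (n := n) ?_ (fun j : Fin n => g j) (fun j k hjk => hg hjk)
    (fun j => Finset.mem_image_of_mem _ (Finset.mem_range.2 j.2)) ⟨i, hi⟩
  rw [Finset.card_image_of_injective _ hg.injective, Finset.card_range]

theorem le_minSpacing_stair {T n k : ℕ} {δ : ℝ} {g : ℕ → ℕ} (hδ : 0 < δ) (hk : 1 ≤ k) (hkT : k ≤ T)
    (hgk : ∀ i, g i + k ≤ g (i + 1)) (hgT : ∀ i < n, k ≤ g i ∧ g i + k ≤ T) :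
    k ≤ minSpacing T (stair δ n g) := by
  have hg : StrictMono g := strictMono_nat_of_lt_succ fun i => by have := hgk i; omega
  have hcp := changePoints_stair (T := T) (n := n) hδ hg fun i hi => by
    have := hgT i hi; omega
  refine le_minSpacing hkT (fun x hx => ?_) (fun x hx y hy hxy => ?_)
  · rw [hcp, Finset.mem_image] at hx
    obtain ⟨i, hi, rfl⟩ := hx
    exact hgT i (Finset.mem_range.1 hi)
  · rw [hcp, Finset.mem_image] at hx hy
    obtain ⟨i, -, rfl⟩ := hx
    obtain ⟨j, -, rfl⟩ := hy
    have hij : i < j := hg.lt_iff_lt.1 hxy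
    have h1 := hgk i
    have h2 := hg.monotone (show i + 1 ≤ j from hij)
    omega

theorem detectable_stair {T n k : ℕ} {C δ : ℝ} {g : ℕ → ℕ} (hδ : 0 < δ) (hk : 1 ≤ k) (hkT : k ≤ T)
    (hgk : ∀ i, g i + k ≤ g (i + 1)) (hgT : ∀ i < n, k ≤ g i ∧ g i + k ≤ T)
    (hC : C * Real.log T ≤ δ ^ 2 * k) : Detectable C T (stair δ n g) := by
  have hg : StrictMono g := strictMono_nat_of_lt_succ fun i => by have := hgk i; omega
  have hcp := changePoints_stair (T := T) (n := n) hδ hg fun i hi => by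
    have := hgT i hi; omega
  refine detectable_of_forall_jump hδ.le (fun x hx => ?_)
    (le_minSpacing_stair hδ hk hkT hgk hgT) hC
  rw [hcp, Finset.mem_image] at hx
  obtain ⟨i, hi, rfl⟩ := hx
  rw [stair_jump hg (Finset.mem_range.1 hi)]
  exact le_abs_self δ

theorem accurate_stair {T n i : ℕ} {B δ : ℝ} {g : ℕ → ℕ} (hδ : 0 < δ) (hg : StrictMono g)
    (hgT : ∀ i < n, 1 ≤ g i ∧ g i < T) {S : Finset ℕ} (hS : Accurate T (stair δ n g) S B)
    (hi : i < n) : δ ^ 2 * |(loc T S (i + 1) : ℝ) - g i| ≤ B := by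
  have h := hS.2 (i + 1) (Finset.mem_Icc.2 ⟨by omega, by
    rw [numChanges_stair hδ hg hgT]; omega⟩)
  rw [jump, eta_stair hδ hg hgT hi, stair_jump hg hi, sq_abs] at h
  exact h

/-- Equidistant locations, with the `j`-th one shifted by one. -/
def shiftedGrid (w : ℕ) (j : Option ℕ) (i : ℕ) : ℕ := w * (i + 1) + if j = some i then 1 else 0

theorem shiftedGrid_none (w i : ℕ) : shiftedGrid w none i = w * (i + 1) := by
  simp [shiftedGrid]

theorem shiftedGrid_self (w i : ℕ) : shiftedGrid w (some i) i = w * (i + 1) + 1 := by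
  simp [shiftedGrid]

theorem shiftedGrid_mem (w : ℕ) (j : Option ℕ) (i : ℕ) :
    w * (i + 1) ≤ shiftedGrid w j i ∧ shiftedGrid w j i ≤ w * (i + 1) + 1 := by
  rw [shiftedGrid]; split_ifs <;> omega

theorem shiftedGrid_add_le {w : ℕ} (hw : 1 ≤ w) (j : Option ℕ) (i : ℕ) :
    shiftedGrid w j i + (w - 1) ≤ shiftedGrid w j (i + 1) := by
  have h1 := shiftedGrid_mem w j i
  have h2 := shiftedGrid_mem w j (i + 1)
  have h3 : w * (i + 1 + 1) = w * (i + 1) + w := by ring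
  omega

theorem shiftedGrid_bounds {w T n : ℕ} (hw : 1 ≤ w) (hT : w * (n + 1) ≤ T) (j : Option ℕ) :
    ∀ i < n, w - 1 ≤ shiftedGrid w j i ∧ shiftedGrid w j i + (w - 1) ≤ T := by
  intro i hi
  have h1 := shiftedGrid_mem w j i
  have h2 : w * (i + 1) ≤ w * n := Nat.mul_le_mul_left w hi
  have h3 : w * (n + 1) = w * n + w := by ring
  have h4 : w * (i + 1) = w * i + w := by ring
  omega

theorem stair_shiftedGrid_sub {δ : ℝ} {n w j : ℕ} (hj : j < n) (t : ℕ) :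
    stair δ n (shiftedGrid w (some j)) t - stair δ n (shiftedGrid w none) t =
      if t = w * (j + 1) + 1 then -δ else 0 := by
  rw [stair, stair, ← Finset.sum_sub_distrib, Finset.sum_eq_single j]
  · rw [shiftedGrid_none, shiftedGrid_self]
    rcases lt_trichotomy t (w * (j + 1) + 1) with h | h | h
    · rw [if_neg (by omega), if_neg (by omega), if_neg (by omega), sub_zero]
    · rw [if_neg (by omega), if_pos (by omega), if_pos h, zero_sub]
    · rw [if_pos (by omega), if_pos (by omega), if_neg (by omega), sub_self]
  · intro i _ hij
    have : shiftedGrid w (some j) i = shiftedGrid w none i := by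
      simp [shiftedGrid, Ne.symm hij]
    rw [this, sub_self]
  · intro h
    exact absurd (Finset.mem_range.2 hj) h

theorem localisation_lower_bound {C : ℝ} (hC : 0 < C) {T w : ℕ} (hw : w = 2 * ⌈C⌉₊ + 3)
    (hT : (7 * w) ^ 2 ≤ T) (est : (Obs T → ℝ) → Finset ℕ)
    (hest : ∀ S, MeasurableSet (est ⁻¹' {S})) :
    ∃ f : ℕ → ℝ, 2 ≤ minSpacing T f ∧ Detectable C T f ∧
      law T f {x | Accurate T f (est x) (1 / 8 * Real.log T)} ≤ ENNReal.ofReal (3 / 4) := by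
  have hw3 : 3 ≤ w := by omega
  have hwT : 49 * w ≤ T := by nlinarith
  have hw3' : (3 : ℝ) ≤ w := by exact_mod_cast hw3
  have hT0 : (1 : ℝ) < T := by exact_mod_cast (by omega : 1 < T)
  have hlog : 0 < Real.log T := Real.log_pos hT0
  -- Shifting one step by one alters a single observation, at energy δ² = (log T)/2. The spacing w -
  -- 1 ≥ 2C then gives δ²λ ≥ C log T.
  set δ := √(1 / 2 * Real.log T) with hδ
  have hδ0 : 0 < δ := Real.sqrt_pos.2 (by positivity)
  have hδsq : δ ^ 2 = 1 / 2 * Real.log T := Real.sq_sqrt (by positivity)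
  set n := T / w - 1 with hn
  have hdiv : 49 ≤ T / w := (Nat.le_div_iff_mul_le (by omega)).2 hwT
  have hnT : w * (n + 1) ≤ T := by
    rw [hn, Nat.sub_add_cancel (by omega)]
    exact Nat.mul_div_le T w
  have hnexp : √(T : ℝ) ≤ (n : ℝ) / 4 := by
    have h1 : 7 * (w : ℝ) ≤ √T := Real.le_sqrt_of_sq_le (by exact_mod_cast hT)
    have h2 : (T : ℝ) < w * (n + 2) := by
      have : T < w * (n + 2) := by
        have := Nat.lt_mul_div_succ T (show 0 < w by omega)
        rwa [show n + 2 = T / w + 1 by omega]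
      exact_mod_cast this
    have h3 : √(T : ℝ) * √T = T := Real.mul_self_sqrt (by linarith)
    have h4 : 7 * (w : ℝ) * √T ≤ √T * √T := mul_le_mul_of_nonneg_right h1 (Real.sqrt_nonneg _)
    have h5 : (w : ℝ) * (7 * √T) < w * (n + 2) := by linarith
    have h6 := lt_of_mul_lt_mul_left h5 (by linarith)
    linarith
  have hsp : ∀ j, 2 ≤ minSpacing T (stair δ n (shiftedGrid w j)) := fun j =>
    le_trans (by omega) (le_minSpacing_stair (k := w - 1) hδ0 (by omega) (by omega)
      (shiftedGrid_add_le (by omega) j) (shiftedGrid_bounds (by omega) hnT j))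
  have hdet : ∀ j, Detectable C T (stair δ n (shiftedGrid w j)) := fun j => by
    refine detectable_stair (k := w - 1) hδ0 (by omega) (by omega)
      (shiftedGrid_add_le (by omega) j) (shiftedGrid_bounds (by omega) hnT j) ?_
    have h1 : 2 * C ≤ ((w - 1 : ℕ) : ℝ) := by
      have h2 := Nat.le_ceil C
      have h3 : w - 1 = 2 * ⌈C⌉₊ + 2 := by omega
      rw [h3]; push_cast; linarith
    rw [hδsq]
    nlinarith
  have hmono : ∀ j, StrictMono (shiftedGrid w j) := fun j =>
    strictMono_nat_of_lt_succ fun i => by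
      have := shiftedGrid_add_le (w := w) (by omega) j i
      omega
  have hrange : ∀ j, ∀ i < n, 1 ≤ shiftedGrid w j i ∧ shiftedGrid w j i < T := fun j i hi => by
    have := shiftedGrid_bounds (w := w) (by omega) hnT j i hi
    omega
  refine (law_le_or_exists_law_le (T := T) (n := n) (by omega) (stair δ n (shiftedGrid w none))
    (fun j => stair δ n (shiftedGrid w (some j))) (v := 1 / 2 * Real.log T) ?_ ?_ ?_
    (B := {x | Accurate T (stair δ n (shiftedGrid w none)) (est x) (1 / 8 * Real.log T)}) ?_
    (E := fun j => {x | Accurate T (stair δ n (shiftedGrid w (some j))) (est x)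
      (1 / 8 * Real.log T)}) ?_).elim ?_ ?_
  · intro i j hij t
    have hij' : (i : ℕ) ≠ j := fun h => hij (Fin.ext h)
    simp only [stair_shiftedGrid_sub i.2, stair_shiftedGrid_sub j.2]
    split_ifs with h1 h2
    · exfalso
      have : w * ((i : ℕ) + 1) = w * (j + 1) := by omega
      have := Nat.eq_of_mul_eq_mul_left (by omega) this
      omega
    all_goals simp
  · intro j
    simp only [stair_shiftedGrid_sub j.2]
    rw [sum_obs_eq T fun t => (if t = w * ((j : ℕ) + 1) + 1 then -δ else 0) ^ 2, ← hδsq]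
    simp only [ite_pow, neg_sq, ne_eq, OfNat.ofNat_ne_zero, not_false_eq_true, zero_pow]
    rw [Finset.sum_ite_eq']
    split_ifs
    · exact le_rfl
    · positivity
  · rwa [exp_half_log (by linarith)]
  -- The estimator has countably many values, so measurable fibres suffice.
  · have : {x | Accurate T (stair δ n (shiftedGrid w none)) (est x) (1 / 8 * Real.log T)} =
        ⋃ S ∈ {S | Accurate T (stair δ n (shiftedGrid w none)) S (1 / 8 * Real.log T)},
          est ⁻¹' {S} := by
      ext x; simp
    rw [this]
    exact MeasurableSet.biUnion (Set.to_countable _) fun S _ => hest S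
  · intro j
    rw [Set.disjoint_left]
    intro x hx hx0
    rw [Set.mem_ofPred_eq] at hx hx0
    have h1 := accurate_stair hδ0 (hmono _) (hrange _) hx j.2
    have h2 := accurate_stair hδ0 (hmono _) (hrange _) hx0 j.2
    rw [shiftedGrid_self] at h1
    rw [shiftedGrid_none] at h2
    -- The two candidate locations differ by one, but each error is at most 1/4, since (log T)/8 =
    -- δ²/4.
    have h3 : (1 : ℝ) ≤ |(loc T (est x) (j + 1) : ℝ) - (w * (j + 1) + 1 : ℕ)| +
        |(loc T (est x) (j + 1) : ℝ) - (w * (j + 1) : ℕ)| := by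
      have := abs_sub_le ((w * (j + 1) + 1 : ℕ) : ℝ) (loc T (est x) (j + 1) : ℝ)
        ((w * (j + 1) : ℕ) : ℝ)
      rw [abs_sub_comm ((w * (j + 1) + 1 : ℕ) : ℝ) (loc T (est x) (j + 1) : ℝ)] at this
      refine le_trans ?_ this
      rw [Nat.cast_succ, add_sub_cancel_left, abs_one]
    have h4 := mul_le_mul_of_nonneg_left h3 (sq_nonneg δ)
    rw [hδsq] at h1 h2 h4
    linarith
  · intro h
    exact ⟨_, hsp none, hdet none, h⟩
  · rintro ⟨j, hj⟩
    exact ⟨_, hsp (some j), hdet (some j), hj⟩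

end SeededBS

theorem theorem3 :
    -- consistency and localisation of seeded binary segmentation
    (∃ C₀ C₁ C₂ : ℝ, 0 < C₀ ∧ 0 < C₁ ∧ 0 < C₂ ∧
      ∀ a : ℝ, 1 / 2 ≤ a → a < 1 →
      ∀ m : ℕ → ℕ, (∀ T, 2 ≤ m T) →
      ∀ f : ℕ → ℕ → ℝ,
        (∀ᶠ T in atTop, (m T : ℝ) ≤ a * (minSpacing T (f T) : ℝ) + 1) →
        (∀ᶠ T in atTop, Detectable C₀ T (f T)) →
        Tendsto
          (fun T : ℕ => law T (f T)
            {x | ∀ S, IsOutput a (m T) (C₁ * √(Real.log T)) x S →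
              Accurate T (f T) S (C₂ * Real.log T)})
          atTop (nhds 1)) ∧
    -- optimality of the detection condition
    (∃ c₀ : ℝ, 0 < c₀ ∧ ∃ p : ENNReal, p < 1 ∧
      ∀ᶠ T : ℕ in atTop, ∀ Nhat : (Obs T → ℝ) → ℕ, Measurable Nhat →
        ∃ f : ℕ → ℝ, 2 ≤ minSpacing T f ∧ Detectable c₀ T f ∧
          law T f {x | Nhat x = numChanges T f} ≤ p) ∧
    -- optimality of the localisation rate
    (∃ c₂ : ℝ, 0 < c₂ ∧ ∃ p : ENNReal, p < 1 ∧
      ∀ C : ℝ, 0 < C →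
      ∀ᶠ T : ℕ in atTop, ∀ est : (Obs T → ℝ) → Finset ℕ,
        (∀ S, MeasurableSet (est ⁻¹' {S})) →
        ∃ f : ℕ → ℝ, 2 ≤ minSpacing T f ∧ Detectable C T f ∧
          law T f {x | Accurate T f (est x) (c₂ * Real.log T)} ≤ p) := by
  -- With M² = 9 log T these are 2304 · 9, 10 · 3 and 24 · 9.
  refine ⟨⟨20736, 30, 216, by norm_num, by norm_num, by norm_num,
    fun a ha ha1 m hm2 f hm hdet => tendsto_law_accurate ha ha1 hm2 hm hdet⟩,
    ⟨1 / 2, by norm_num, ENNReal.ofReal (3 / 4), ?_, ?_⟩,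
    ⟨1 / 8, by norm_num, ENNReal.ofReal (3 / 4), ?_, ?_⟩⟩
  · rw [ENNReal.ofReal_lt_one]; norm_num
  · filter_upwards [eventually_ge_atTop 256] with T hT
    exact detection_lower_bound hT
  · rw [ENNReal.ofReal_lt_one]; norm_num
  · intro C hC
    filter_upwards [eventually_ge_atTop ((7 * (2 * ⌈C⌉₊ + 3)) ^ 2)] with T hT
    exact localisation_lower_bound hC rfl hT
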